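/- Conventions. An FI-set $V_\bullet$ is a functor from the category of the sets $[n]=\{1,\dots,n\}$ ($n\ge 0$) and injections to finite sets; it is finitely generated if for some $d$ and all $n\ge d$ the set $V_{n+1}$ is the union of the images of $V_n$ under the maps induced by the injections $[n]\hookrightarrow[n+1]$. An FI-graph $G_\bullet$ is a functor from the same category to finite simple graphs and graph homomorphisms, with vertex FI-set $V_\bullet$; it is transitive if $V_\bullet$ is finitely generated and $\mathfrak S_n$ acts transitively on $V_n$ for all large $n$. Assume that $G_\bullet$ is transitive and that for all large $n$ the graph $G_n$ is connected and has more than one vertex. Let $P_n$ be the transition matrix of the simple random walk on $G_n$. For $x\in V_m$ and $n\ge m$ let $x(n)\in V_n$ be the image of $x$ under the standard inclusion $[m]\hookrightarrow[n]$. The orbit graph $G_n^x$ has as vertices the $\mathfrak S_n$-orbits $[y,x(n)]$ of pairs of vertices of $G_n$ with second entry $x(n)$; $[y,x(n)]$ and $[z,x(n)]$ are joined (loops allowed) if some $z'$ with $[z',x(n)]=[z,x(n)]$ is adjacent to $y$. The orbit walk has transition matrix $$P^x_n([y,x(n)],[z,x(n)])=\sum_{z'\,:\,[z',x(n)]=[z,x(n)]}P_n(y,z').$$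 Suppose that $m$ and $x\in V_m$ are such that $G_n^x$ does not change for $n\ge m$: the natural maps $[y,x]\mapsto[y(n),x(n)]$ from $G_m^x$ to $G_n^x$ are graph isomorphisms for all $n\ge m$. Use them to regard all $P^x_n$ ($n\ge m$) as matrices on the vertex set $\mathcal X$ of $G_m^x$. Proposition. (1) $\{P^x_n\}_{n\ge m}$ is a rational transition from $P^x_m$ to some Markov chain $Q$ on $\mathcal X$: all $P_n^x$ are transition matrices, each entry of $P^x_n$ is, for all $n\ge m$, the value at $n$ of a rational function in $\mathbb R(n)$ without a pole there, and $\lim_{n\to\infty}P^x_n$ exists and is the transition matrix $Q$. (2) There are $d\le m$, a subgroup $H\le\mathfrak S_d$ and isomorphisms of $\mathfrak S_n$-sets $V_n\cong\mathfrak S_n/(H\times\mathfrak S_{n-d})$ for all $n\ge m$. For any such $d$, $H$ and isomorphisms, let the labels of the vertex corresponding to $[\sigma]$ be the sets $\sigma(\alpha)\subseteq[n]$, where $\alpha$ runs over the $H$-orbits of $[d]$. Then $$\pi_\infty([y,x(n)])=\begin{cases}0&\text{if some label of $y$ meets some label of $x(n)$,}\\1&\text{if no label of $y$ meets a label of $x(n)$}\end{cases}$$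 defines, independently of $n\ge m$, a probability distribution on $\mathcal X$, and it is a stationary distribution of $Q$: $\pi_\infty Q=\pi_\infty$. Moreover each $P^x_n$, $n\ge m$, has a unique stationary distribution $\pi_n$, and $\pi_n\to\pi_\infty$ as $n\to\infty$. -/

import Mathlib

open Filter Topology

universe u

/-- An FI-set: a functor from the category of the sets `[n]` (here `Fin n`) and injections
to finite sets. -/
structure FISet where
  obj : ℕ → Type u
  fintypeObj : ∀ n, Fintype (obj n)
  map : ∀ {a b : ℕ}, (Fin a ↪ Fin b) → obj a → obj b
  map_refl : ∀ {a : ℕ} (v : obj a), map (Function.Embedding.refl (Fin a)) v = v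
  map_trans : ∀ {a b c : ℕ} (f : Fin a ↪ Fin b) (g : Fin b ↪ Fin c) (v : obj a),
    map (f.trans g) v = map g (map f v)

attribute [instance] FISet.fintypeObj

namespace FISet

variable (V : FISet.{u})

/-- The action of a permutation of `[n]` on `V_n`. -/
def act {n : ℕ} (σ : Equiv.Perm (Fin n)) (v : V.obj n) : V.obj n :=
  V.map σ.toEmbedding v

theorem act_one {n : ℕ} (v : V.obj n) : V.act 1 v = v := V.map_refl v

theorem act_mul {n : ℕ} (σ τ : Equiv.Perm (Fin n)) (v : V.obj n) :
    V.act (σ * τ) v = V.act σ (V.act τ v) := V.map_trans τ.toEmbedding σ.toEmbedding v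

theorem act_inv_act {n : ℕ} (σ : Equiv.Perm (Fin n)) (v : V.obj n) :
    V.act σ⁻¹ (V.act σ v) = v := by
  rw [← act_mul, inv_mul_cancel, act_one]

theorem act_act_inv {n : ℕ} (σ : Equiv.Perm (Fin n)) (v : V.obj n) :
    V.act σ (V.act σ⁻¹ v) = v := by
  rw [← act_mul, mul_inv_cancel, act_one]

def actEquiv {n : ℕ} (σ : Equiv.Perm (Fin n)) : V.obj n ≃ V.obj n where
  toFun := V.act σ
  invFun := V.act σ⁻¹
  left_inv := V.act_inv_act σ
  right_inv := V.act_act_inv σ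

/-- `V` is finitely generated: for some `d` and all `n ≥ d`, the set `V_{n+1}` is the union of the
images of `V_n` under the maps induced by the injections `[n] → [n+1]`. -/
def IsFinitelyGenerated : Prop :=
  ∃ d : ℕ, ∀ n, d ≤ n → ∀ w : V.obj (n + 1), ∃ (f : Fin n ↪ Fin (n + 1)) (v : V.obj n),
    V.map f v = w

/-- The image `x(m+k)` of `x ∈ V_m` under the standard inclusion `[m] → [m+k]`. -/
def stdIncl {m : ℕ} (k : ℕ) (x : V.obj m) : V.obj (m + k) := V.map (Fin.castAddEmb k) x

/-- `y` and `z` are identified when the pairs `(y, x)` and `(z, x)` lie in the same orbit of the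
symmetric group on `V_n × V_n`. -/
def pairSetoid {n : ℕ} (x : V.obj n) : Setoid (V.obj n) where
  r y z := ∃ σ : Equiv.Perm (Fin n), V.act σ y = z ∧ V.act σ x = x
  iseqv :=
    { refl := fun y => ⟨1, V.act_one y, V.act_one x⟩
      symm := by
        rintro y z ⟨σ, rfl, hx⟩
        refine ⟨σ⁻¹, V.act_inv_act σ y, ?_⟩
        conv_lhs => rw [← hx]
        exact V.act_inv_act σ x
      trans := by
        rintro y z w ⟨σ, rfl, hx⟩ ⟨τ, rfl, hx'⟩
        exact ⟨τ * σ, V.act_mul τ σ y, by rw [act_mul, hx, hx']⟩ }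

/-- The set of orbits of pairs of the form `[y, x]`, for a fixed vertex `x ∈ V_n`. -/
def PairOrbit {n : ℕ} (x : V.obj n) : Type u := Quotient (V.pairSetoid x)

/-- The orbit `[y, x]`. -/
def pairOrbit {n : ℕ} (x y : V.obj n) : V.PairOrbit x := Quotient.mk (V.pairSetoid x) y

open Classical in
noncomputable instance {n : ℕ} (x : V.obj n) : Fintype (V.PairOrbit x) :=
  Fintype.ofSurjective (V.pairOrbit x) Quotient.mk_surjective

/-- An extension of a permutation of `[m]` to `[m+k]`, by the identity. -/
theorem exists_extend {m : ℕ} (k : ℕ) (σ : Equiv.Perm (Fin m)) :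
    ∃ τ : Equiv.Perm (Fin (m + k)), ∀ v : V.obj m, V.act τ (V.stdIncl k v)
      = V.stdIncl k (V.act σ v) := by
  refine ⟨finSumFinEquiv.permCongr (Equiv.sumCongr σ (Equiv.refl (Fin k))), fun v => ?_⟩
  unfold act stdIncl
  rw [← V.map_trans, ← V.map_trans]
  congr 1
  ext i
  simp [Equiv.permCongr_apply]

/-- The natural map `[y, x] ↦ [y(m+k), x(m+k)]` between sets of orbits of pairs. -/
def orbitIncl {m : ℕ} (x : V.obj m) (k : ℕ) : V.PairOrbit x → V.PairOrbit (V.stdIncl k x) :=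
  Quotient.map' (V.stdIncl k) (by
    rintro y z ⟨σ, rfl, hx⟩
    obtain ⟨τ, hτ⟩ := V.exists_extend k σ
    exact ⟨τ, hτ y, by rw [hτ x, hx]⟩)

/-- The subgroup `H × 𝔖_{n-d}` of `𝔖_n`, for `H ≤ 𝔖_d`: the permutations of `[n]` that preserve
`[d]` and act on it through an element of `H`. -/
def blockSubgroup {d n : ℕ} (hd : d ≤ n) (H : Subgroup (Equiv.Perm (Fin d))) :
    Subgroup (Equiv.Perm (Fin n)) where
  carrier := {σ | ∃ h ∈ H, ∀ i : Fin d, σ (Fin.castLE hd i) = Fin.castLE hd (h i)}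
  one_mem' := ⟨1, H.one_mem, fun _ => rfl⟩
  mul_mem' := by
    rintro σ τ ⟨h, hh, h1⟩ ⟨g, hg, h2⟩
    exact ⟨h * g, H.mul_mem hh hg, fun i => by simp [h1, h2]⟩
  inv_mem' := by
    rintro σ ⟨h, hh, h1⟩
    refine ⟨h⁻¹, H.inv_mem hh, fun i => ?_⟩
    rw [Equiv.Perm.inv_eq_iff_eq, h1]
    simp

/-- For `α` the `H`-orbit of `a ∈ [d]`, the label `S_α = σ(α) ⊆ [n]` of the class `[σ]` in
`𝔖_n / (H × 𝔖_{n-d})`. It does not depend on the representative `σ`. -/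
def label {d n : ℕ} (hd : d ≤ n) (H : Subgroup (Equiv.Perm (Fin d)))
    (q : Equiv.Perm (Fin n) ⧸ blockSubgroup hd H) (a : Fin d) : Set (Fin n) :=
  {i | ∃ σ : Equiv.Perm (Fin n), (QuotientGroup.mk σ : Equiv.Perm (Fin n) ⧸ blockSubgroup hd H) = q ∧
    ∃ b ∈ MulAction.orbit H a, σ (Fin.castLE hd b) = i}

/-- A description of `V_n`, for all `n ≥ m`, as the `𝔖_n`-set `𝔖_n / (H × 𝔖_{n-d})`, with `d` and
`H ≤ 𝔖_d` independent of `n`. -/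
structure LabelDescription (m : ℕ) where
  d : ℕ
  d_le : d ≤ m
  H : Subgroup (Equiv.Perm (Fin d))
  equiv : ∀ k : ℕ, V.obj (m + k) ≃
    Equiv.Perm (Fin (m + k)) ⧸ blockSubgroup (d_le.trans (Nat.le_add_right m k)) H
  equivariant : ∀ (k : ℕ) (σ : Equiv.Perm (Fin (m + k))) (v : V.obj (m + k)),
    equiv k (V.act σ v) = σ • equiv k v

/-- No label of `y` meets a label of `z`. -/
def LabelDescription.LabelsDisjoint {V : FISet.{u}} {m : ℕ} (L : V.LabelDescription m) {k : ℕ}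
    (y z : V.obj (m + k)) : Prop :=
  ∀ a b : Fin L.d,
    Disjoint (label (L.d_le.trans (Nat.le_add_right m k)) L.H (L.equiv k y) a)
      (label (L.d_le.trans (Nat.le_add_right m k)) L.H (L.equiv k z) b)

end FISet

/-- An FI-graph: a functor from FI to finite graphs and graph homomorphisms. -/
structure FIGraph extends FISet.{u} where
  graph : ∀ n, SimpleGraph (obj n)
  map_adj : ∀ {a b : ℕ} (f : Fin a ↪ Fin b) {v w : obj a},
    (graph a).Adj v w → (graph b).Adj (map f v) (map f w)

open Classical in
/-- The transition matrix of the simple random walk on a finite graph. -/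
noncomputable def simpleRandomWalk {X : Type u} [Fintype X] (G : SimpleGraph X) : Matrix X X ℝ :=
  Matrix.of fun y z => if G.Adj y z then 1 / (G.degree y : ℝ) else 0

namespace FIGraph

variable (G : FIGraph.{u})

/-- `G` is finitely generated, and `𝔖_n` acts transitively on the vertices of `G_n` for all large
`n`. -/
def IsTransitive : Prop :=
  G.toFISet.IsFinitelyGenerated ∧
    ∀ᶠ n in atTop, ∀ v w : G.obj n, ∃ σ : Equiv.Perm (Fin n), G.act σ v = w

theorem adj_act_iff {n : ℕ} (σ : Equiv.Perm (Fin n)) (y z : G.obj n) :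
    (G.graph n).Adj (G.act σ y) (G.act σ z) ↔ (G.graph n).Adj y z := by
  refine ⟨fun h => ?_, fun h => G.map_adj _ h⟩
  have := G.map_adj σ⁻¹.toEmbedding h
  rwa [← FISet.act, ← FISet.act, G.act_inv_act, G.act_inv_act] at this

theorem simpleRandomWalk_act {n : ℕ} (σ : Equiv.Perm (Fin n)) (y z : G.obj n) :
    simpleRandomWalk (G.graph n) (G.act σ y) (G.act σ z) = simpleRandomWalk (G.graph n) y z := by
  classical
  have hdeg : (G.graph n).degree (G.act σ y) = (G.graph n).degree y := by
    let e : G.graph n ≃g G.graph n := ⟨G.actEquiv σ, fun {a b} => G.adj_act_iff σ a b⟩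
    have := e.degree_eq y
    exact this
  simp only [simpleRandomWalk, Matrix.of_apply, G.adj_act_iff]
  congr! 3

/-- Adjacency in the `x`-roofed orbit graph: `[y, x]` and `[z, x]` are joined when a vertex `z'` with
`[z', x] = [z, x]` is adjacent to `y`. Loops may occur. -/
def orbitAdj {n : ℕ} (x : G.obj n) (a b : G.PairOrbit x) : Prop :=
  ∃ y z : G.obj n, G.pairOrbit x y = a ∧ G.pairOrbit x z = b ∧ (G.graph n).Adj y z

open Classical in
/-- The transition matrix of the orbit walk: the entry at `([y, x], [z, x])` is the sum of
`P_n(y, z')` over all `z'` with `[z', x] = [z, x]`, where `P_n` is the simple random walk. -/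
noncomputable def orbitWalk {n : ℕ} (x : G.obj n) : Matrix (G.PairOrbit x) (G.PairOrbit x) ℝ :=
  Matrix.of fun a b => Quotient.liftOn a
    (fun y => ∑ z' : G.obj n,
      if G.pairOrbit x z' = b then simpleRandomWalk (G.graph n) y z' else 0)
    (by
      rintro y w ⟨σ, rfl, hx⟩
      refine Fintype.sum_equiv (G.actEquiv σ) _ _ fun z' => ?_
      have h : G.pairOrbit x (G.actEquiv σ z') = G.pairOrbit x z' :=
        (Quotient.sound (s := G.pairSetoid x) ⟨σ, rfl, hx⟩).symm
      have h2 := G.simpleRandomWalk_act σ y z'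
      rw [h]
      exact if_congr Iff.rfl h2.symm rfl)

/-- The orbit graphs `G_n^x` do not change for `n ≥ m`: the natural maps
`[y, x] ↦ [y(n), x(n)]` are isomorphisms of graphs. -/
def OrbitGraphStable {m : ℕ} (x : G.obj m) : Prop :=
  ∀ k : ℕ, Function.Bijective (G.orbitIncl x k) ∧
    ∀ a b : G.PairOrbit x,
      G.orbitAdj (G.stdIncl k x) (G.orbitIncl x k a) (G.orbitIncl x k b) ↔ G.orbitAdj x a b

/-- The orbit walk `P^x_{m+k}`, as a matrix on the common vertex set of the orbit graphs. -/
noncomputable def orbitWalkAt {m : ℕ} (x : G.obj m) (k : ℕ) :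
    Matrix (G.PairOrbit x) (G.PairOrbit x) ℝ :=
  (G.orbitWalk (G.stdIncl k x)).submatrix (G.orbitIncl x k) (G.orbitIncl x k)

end FIGraph

open Classical in
/-- The transition matrices of Markov chains on a finite set `X`. -/
def IsTransitionMatrix {X : Type u} [Fintype X] (P : Matrix X X ℝ) : Prop :=
  P ∈ Matrix.rowStochastic ℝ X

/-- `π` is a probability distribution on `X` with `π P = π`. -/
def IsStationaryDistribution {X : Type u} [Fintype X] (P : Matrix X X ℝ) (π : X → ℝ) : Prop :=
  π ∈ stdSimplex ℝ X ∧ Matrix.vecMul π P = π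

/-- A rational transition from the Markov chain `P` to the Markov chain `Q`: a family of Markov
chains `R 0, R 1, …` whose entries are the values at `n` of rational functions (without a pole
there), with `R 0 = P` and `R n → Q`. -/
structure IsRationalTransition {X : Type u} [Fintype X] (P Q : Matrix X X ℝ)
    (R : ℕ → Matrix X X ℝ) : Prop where
  isTransitionMatrix_source : IsTransitionMatrix P
  isTransitionMatrix_target : IsTransitionMatrix Q
  isTransitionMatrix : ∀ n, IsTransitionMatrix (R n)
  rational : ∃ F : Matrix X X (RatFunc ℝ), ∀ (n : ℕ) (a b : X),
    (F a b).denom.eval (n : ℝ) ≠ 0 ∧ R n a b = (F a b).eval (RingHom.id ℝ) (n : ℝ)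
  zero : R 0 = P
  tendsto : Tendsto R atTop (𝓝 Q)

/-!
The idea is to reduce everything to counting embeddings `[d] → [n]`.

*Structure of `V_n`.* Stability of the orbits forces `x(n)` to be the only vertex of `V_n` that
becomes `x(N)` (`OrbitsStable.eq_of_incl_eq`), so `Stab x(n) = Stab x(N) ∩ 𝔖_n` for `m ≤ n ≤ N`.
Call `i ∈ [m]` a point of the support of `x` if its transposition with a point outside `[m]` moves
`x(N)`. The stabilizer contains all transpositions outside the support; passing to a large `N` it
follows that it preserves the support. Hence it consists of the permutations that act on the
support through some `H ≤ 𝔖_d`, where neither `d` nor `H` depends on `n`. Transitivity for large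
`n` descends to all `n ≥ m`, and since a vertex with support disjoint from that of `x` must be
represented in `V_m`, one gets `2d ≤ m`. This is `OrbitsStable.exists_isSupported`.
Vertices of `V_n` are thus embeddings `[d] → [n]` up to `H`.

*Rationality.* Adjacency of `y(n)` and `z`, and the orbit `[z, x(n)]`, depend only on the trace of
the support of `z` in `[m]`; the number of embeddings with a given trace is a falling factorial in
`n - m`. So degrees and numbers of neighbours in an orbit are polynomials
(`IsSupported.exists_poly_card`), and the entries of the orbit walk are quotients of these. They lie
in `[0, 1]`, hence converge.

*Stationary distributions.* By transitivity `G_n` is regular, so the uniform distribution is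
stationary and `π_n` is its image on the orbits; it is unique because the orbit graph is connected,
being a quotient of a connected `G_N`. The vertices with support disjoint from that of `x(n)` form
one orbit, and the proportion of them tends to `1` (`FIGraph.le_orbitMeasure_of_disjoint`), so
`π_n` converges to the point mass at this orbit, which is stationary for the limit `Q`.

*Labels.* In an arbitrary description of the `V_n`, the union of the labels of `x(n)` is, like the
support, a `Stab x(n)`-invariant set outside of which all transpositions lie in `Stab x(n)`. Two
such sets whose complements meet are equal, so they have the same size `d ≤ n / 2` (take `n` large);
for small `n` they might also be complementary, of size `n / 2`. In both cases
disjointness of labels is disjointness of supports (`IsSupported.labelsDisjoint_vert_iff`).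
-/

/-! ### Permutations, supports, polynomials and Markov chains -/

/-- Two embeddings of a finite type into a finite type differ by a permutation of the target. -/
theorem exists_perm_extending {ι α : Type*} [Finite ι] [Finite α] (f g : ι ↪ α) :
    ∃ σ : Equiv.Perm α, ∀ i, σ (f i) = g i := by
  classical
  have := Fintype.ofFinite α
  let e : {a // a ∈ Set.range f} ≃ {a // a ∈ Set.range g} :=
    (Equiv.ofInjective f f.injective).symm.trans (Equiv.ofInjective g g.injective)
  refine ⟨e.extendSubtype, fun i => ?_⟩
  rw [Equiv.extendSubtype_apply_of_mem e _ ⟨i, rfl⟩]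
  simp [e]

/-- A subgroup containing all transpositions of points of `C` contains every permutation that
fixes the complement of `C` pointwise. -/
theorem Equiv.Perm.mem_of_swap_mem {α : Type*} [Fintype α] [DecidableEq α]
    (K : Subgroup (Equiv.Perm α)) (C : Set α)
    (hK : ∀ i ∈ C, ∀ j ∈ C, Equiv.swap i j ∈ K) (σ : Equiv.Perm α)
    (hσ : ∀ i, i ∉ C → σ i = i) : σ ∈ K := by
  induction h : σ.support.card using Nat.strong_induction_on generalizing σ with
  | _ n ih =>
    by_cases h1 : σ = 1
    · exact h1 ▸ K.one_mem
    obtain ⟨i, hi⟩ : ∃ i, σ i ≠ i := by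
      by_contra! hc
      exact h1 (Equiv.ext hc)
    have hiC : i ∈ C := by
      by_contra hc
      exact hi (hσ i hc)
    have hsC : σ i ∈ C := by
      by_contra hc
      exact hi (σ.injective (hσ _ hc))
    have hmem : Equiv.swap i (σ i) * σ ∈ K := by
      refine ih _ (h ▸ Equiv.Perm.card_support_swap_mul hi) _ (fun j hj => ?_) rfl
      rw [Equiv.Perm.mul_apply, hσ j hj, Equiv.swap_apply_of_ne_of_ne]
      · rintro rfl; exact hj hiC
      · rintro rfl; exact hj hsC
    simpa using K.mul_mem (hK i hiC _ hsC) hmem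

section Supports

variable {α : Type*} [DecidableEq α] {K : Subgroup (Equiv.Perm α)} {S T : Finset α}

/-- Two invariant sets whose complements are orbits of `K` coincide as soon as their complements
meet. -/
theorem eq_of_swap_mem_of_notMem (hS : ∀ σ ∈ K, ∀ i ∈ S, σ i ∈ S) (hT : ∀ σ ∈ K, ∀ i ∈ T, σ i ∈ T)
    (hS' : ∀ i j, i ∉ S → j ∉ S → Equiv.swap i j ∈ K)
    (hT' : ∀ i j, i ∉ T → j ∉ T → Equiv.swap i j ∈ K)
    {i : α} (hiS : i ∉ S) (hiT : i ∉ T) : S = T := by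
  ext j
  constructor <;> intro hj
  · by_contra hc
    have := hS _ (hT' j i hc hiT) j hj
    rw [Equiv.swap_apply_left] at this
    exact hiS this
  · by_contra hc
    have := hT _ (hS' j i hc hiS) j hj
    rw [Equiv.swap_apply_left] at this
    exact hiT this

theorem eq_of_swap_mem_of_two_mul_card_lt [Fintype α]
    (hS : ∀ σ ∈ K, ∀ i ∈ S, σ i ∈ S) (hT : ∀ σ ∈ K, ∀ i ∈ T, σ i ∈ T)
    (hS' : ∀ i j, i ∉ S → j ∉ S → Equiv.swap i j ∈ K)
    (hT' : ∀ i j, i ∉ T → j ∉ T → Equiv.swap i j ∈ K)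
    (h1 : 2 * S.card < Fintype.card α) (h2 : 2 * T.card < Fintype.card α) : S = T := by
  have h3 : (S ∪ T).card < (Finset.univ : Finset α).card := by
    have := Finset.card_union_le S T
    rw [Finset.card_univ]
    omega
  obtain ⟨i, -, hi⟩ := Finset.exists_mem_notMem_of_card_lt_card h3
  rw [Finset.mem_union, not_or] at hi
  exact eq_of_swap_mem_of_notMem hS hT hS' hT' hi.1 hi.2

/-- When `|S| = |T| = |α| / 2`, the two sets may be complementary instead of equal; being disjoint
from a translate is insensitive to this. -/
theorem disjoint_map_iff_of_swap_mem [Fintype α]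
    (hS : ∀ σ ∈ K, ∀ i ∈ S, σ i ∈ S) (hT : ∀ σ ∈ K, ∀ i ∈ T, σ i ∈ T)
    (hS' : ∀ i j, i ∉ S → j ∉ S → Equiv.swap i j ∈ K)
    (hT' : ∀ i j, i ∉ T → j ∉ T → Equiv.swap i j ∈ K)
    (hST : S.card = T.card) (h1 : 2 * S.card ≤ Fintype.card α) (τ : Equiv.Perm α) :
    (∀ i ∈ S, τ i ∉ S) ↔ (∀ i ∈ T, τ i ∉ T) := by
  by_cases h : ∃ i, i ∉ S ∧ i ∉ T
  · obtain ⟨i, hi, hi'⟩ := h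
    rw [eq_of_swap_mem_of_notMem hS hT hS' hT' hi hi']
  push Not at h
  have hun : S ∪ T = Finset.univ := by
    ext i
    by_cases hi : i ∈ S
    · simp [hi]
    · simp [h i hi]
  have hcard := Finset.card_union_add_card_inter S T
  rw [hun, Finset.card_univ] at hcard
  have hdis : S ∩ T = ∅ := by
    rw [← Finset.card_eq_zero]
    omega
  have hT_eq : T = Sᶜ := by
    ext i
    rw [Finset.mem_compl]
    refine ⟨fun hi hi' => ?_, h i⟩
    have : i ∈ S ∩ T := Finset.mem_inter.2 ⟨hi', hi⟩
    simp [hdis] at this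
  have key : ∀ A : Finset α, A.card = Aᶜ.card → (∀ i ∈ A, τ i ∉ A) → ∀ i ∈ Aᶜ, τ i ∉ Aᶜ := by
    intro A hA hd i hi hi'
    have hmap : A.map τ.toEmbedding = Aᶜ := by
      refine Finset.eq_of_subset_of_card_le (fun j hj => ?_) (by rw [Finset.card_map, hA])
      obtain ⟨l, hl, rfl⟩ := Finset.mem_map.1 hj
      exact Finset.mem_compl.2 (hd l hl)
    rw [← hmap] at hi'
    obtain ⟨l, hl, hl'⟩ := Finset.mem_map.1 hi'
    have : l = i := τ.injective hl'
    exact Finset.mem_compl.1 hi (this ▸ hl)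
  have hcc : S.card = Sᶜ.card := by rw [← hT_eq, hST]
  rw [hT_eq]
  refine ⟨key S hcc, fun hd => ?_⟩
  have := key Sᶜ (by rw [compl_compl]; exact hcc.symm) hd
  rwa [compl_compl] at this

end Supports

/-- A quotient of polynomials that is bounded along the natural numbers converges along them. -/
theorem Polynomial.exists_tendsto_eval_div_eval (p q : Polynomial ℝ)
    (h : ∀ k : ℕ, |p.eval (k : ℝ) / q.eval (k : ℝ)| ≤ 1) :
    ∃ l : ℝ, Tendsto (fun k : ℕ => p.eval (k : ℝ) / q.eval (k : ℝ)) atTop (𝓝 l) := by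
  have hcast := tendsto_natCast_atTop_atTop (R := ℝ)
  rcases lt_trichotomy p.degree q.degree with hd | hd | hd
  · exact ⟨0, (Polynomial.div_tendsto_atTop_zero_of_degree_lt p q hd).comp hcast⟩
  · exact ⟨_, (Polynomial.div_tendsto_atTop_leadingCoeff_div_of_degree_eq p q hd).comp hcast⟩
  · by_cases hq : q = 0
    · exact ⟨0, by simp [hq]⟩
    have h1 := (Polynomial.abs_div_tendsto_atTop_atTop_of_degree_gt p q hd hq).comp hcast
    obtain ⟨k, hk⟩ := (h1.eventually_gt_atTop 1).exists
    exact absurd (h k) (not_le.2 hk)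

/-- The value of a quotient of polynomials, seen as a rational function, at a point where the
denominator does not vanish. -/
theorem RatFunc.eval_algebraMap_div {K : Type*} [Field K] (p q : Polynomial K) {a : K}
    (hq : q.eval a ≠ 0) :
    (algebraMap (Polynomial K) (RatFunc K) p / algebraMap (Polynomial K) (RatFunc K) q).denom.eval a
        ≠ 0 ∧
      (algebraMap (Polynomial K) (RatFunc K) p /
        algebraMap (Polynomial K) (RatFunc K) q).eval (RingHom.id K) a = p.eval a / q.eval a := by
  have hq0 : q ≠ 0 := by rintro rfl; simp at hq
  set F := algebraMap (Polynomial K) (RatFunc K) p / algebraMap (Polynomial K) (RatFunc K) q with hF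
  have hdvd : F.denom ∣ q := RatFunc.denom_div_dvd p q
  have hden : F.denom.eval a ≠ 0 := by
    obtain ⟨r, hr⟩ := hdvd
    intro h0
    rw [hr, Polynomial.eval_mul, h0, zero_mul] at hq
    exact hq rfl
  refine ⟨hden, ?_⟩
  have hcross : F.num * q = p * F.denom := (RatFunc.num_mul_eq_mul_denom_iff hq0).2 hF
  have := congrArg (Polynomial.eval a) hcross
  rw [Polynomial.eval_mul, Polynomial.eval_mul] at this
  rw [RatFunc.eval, Polynomial.eval₂_id, Polynomial.eval₂_id, div_eq_div_iff hden hq, this]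

open Classical in
/-- A Markov chain whose transition graph is strongly connected has at most one stationary
distribution: for the least ratio `c = ρ b / π b`, the vector `ρ - c π` is nonnegative, invariant
and vanishes at `b`, hence at every state leading to `b`. -/
theorem IsStationaryDistribution.unique {X : Type u} [Fintype X] {P : Matrix X X ℝ}
    (hP : ∀ a b, 0 ≤ P a b) (hirr : ∀ a b, Relation.ReflTransGen (fun a b => 0 < P a b) a b)
    {π ρ : X → ℝ} (hπ : IsStationaryDistribution P π) (hπ0 : ∀ a, 0 < π a)
    (hρ : IsStationaryDistribution P ρ) : ρ = π := by
  have hne : Nonempty X := by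
    by_contra hc
    rw [not_nonempty_iff] at hc
    have := hπ.1.2
    simp at this
  obtain ⟨b, hb⟩ := Finite.exists_min (fun a => ρ a / π a)
  set c := ρ b / π b with hc
  let v : X → ℝ := fun a => ρ a - c * π a
  have hv0 : ∀ a, 0 ≤ v a := fun a => by
    have := hb a
    rw [le_div_iff₀ (hπ0 a)] at this
    exact sub_nonneg.2 this
  have hvb : v b = 0 := by
    simp only [v, hc]
    rw [div_mul_cancel₀ _ (hπ0 b).ne', sub_self]
  have hinv : ∀ j, ∑ i, v i * P i j = v j := fun j => by
    have h1 := congrFun hπ.2 j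
    have h2 := congrFun hρ.2 j
    simp only [Matrix.vecMul, dotProduct] at h1 h2
    simp only [v, sub_mul, Finset.sum_sub_distrib, h2, mul_assoc, ← Finset.mul_sum, h1]
  have hback : ∀ i j, 0 < P i j → v j = 0 → v i = 0 := fun i j hij hj => by
    have h1 := hinv j
    rw [hj, Finset.sum_eq_zero_iff_of_nonneg fun i _ => mul_nonneg (hv0 i) (hP i j)] at h1
    exact (mul_eq_zero.1 (h1 i (Finset.mem_univ i))).resolve_right hij.ne'
  have hvz : ∀ a, v a = 0 := fun a => by
    induction hirr a b using Relation.ReflTransGen.head_induction_on with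
    | refl => exact hvb
    | head h _ ih => exact hback _ _ h ih
  have hρc : ∀ a, ρ a = c * π a := fun a => sub_eq_zero.1 (hvz a)
  have hc1 : c = 1 := by
    have h1 := hρ.1.2
    simp only [hρc, ← Finset.mul_sum, hπ.1.2, mul_one] at h1
    exact h1
  funext a
  rw [hρc, hc1, one_mul]

/-! ### Stable orbits and the support of a vertex -/

namespace FISet

variable {V : FISet.{u}}

/-- The image `x(n) ∈ V_n` of `x ∈ V_m` under the standard inclusion `[m] → [n]`. Unlike `stdIncl`,
it is indexed by `n` and not by `n - m`, so that inclusions compose without casts. -/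
def incl (V : FISet.{u}) {m n : ℕ} (h : m ≤ n) (v : V.obj m) : V.obj n := V.map (Fin.castLEEmb h) v

theorem stdIncl_eq_incl {m : ℕ} (k : ℕ) (x : V.obj m) :
    V.stdIncl k x = V.incl (Nat.le_add_right m k) x := rfl

theorem incl_refl {m : ℕ} (x : V.obj m) : V.incl le_rfl x = x := V.map_refl x

theorem incl_incl {a b c : ℕ} (hab : a ≤ b) (hbc : b ≤ c) (x : V.obj a) :
    V.incl hbc (V.incl hab x) = V.incl (hab.trans hbc) x :=
  (V.map_trans (Fin.castLEEmb hab) (Fin.castLEEmb hbc) x).symm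

theorem act_incl_of_extends {m n : ℕ} (h : m ≤ n) {σ : Equiv.Perm (Fin m)} {τ : Equiv.Perm (Fin n)}
    (hτ : ∀ i, τ (Fin.castLE h i) = Fin.castLE h (σ i)) (v : V.obj m) :
    V.act τ (V.incl h v) = V.incl h (V.act σ v) := by
  unfold act incl
  rw [← V.map_trans, ← V.map_trans]
  congr 1
  ext i
  simp [hτ]

theorem act_incl_of_fixes {m n : ℕ} (h : m ≤ n) {τ : Equiv.Perm (Fin n)}
    (hτ : ∀ i, τ (Fin.castLE h i) = Fin.castLE h i) (v : V.obj m) :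
    V.act τ (V.incl h v) = V.incl h v := by
  rw [act_incl_of_extends h (σ := 1) hτ, act_one]

theorem exists_perm_extends {m n : ℕ} (h : m ≤ n) (σ : Equiv.Perm (Fin m)) :
    ∃ τ : Equiv.Perm (Fin n), ∀ i, τ (Fin.castLE h i) = Fin.castLE h (σ i) :=
  exists_perm_extending (Fin.castLEEmb h) (σ.toEmbedding.trans (Fin.castLEEmb h))

/-- The stabilizer of `v` in the symmetric group. -/
def stab (V : FISet.{u}) {n : ℕ} (v : V.obj n) : Subgroup (Equiv.Perm (Fin n)) where
  carrier := {σ | V.act σ v = v}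
  one_mem' := V.act_one v
  mul_mem' := fun {σ τ} hσ hτ => by
    change V.act (σ * τ) v = v
    rw [act_mul, show V.act τ v = v from hτ, show V.act σ v = v from hσ]
  inv_mem' := fun {σ} hσ => by
    change V.act σ⁻¹ v = v
    conv_lhs => rw [← show V.act σ v = v from hσ]
    exact V.act_inv_act σ v

theorem mem_stab {n : ℕ} {v : V.obj n} {σ : Equiv.Perm (Fin n)} :
    σ ∈ V.stab v ↔ V.act σ v = v := Iff.rfl

theorem inv_mul_mem_stab {n : ℕ} {v : V.obj n} {σ τ : Equiv.Perm (Fin n)} :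
    σ⁻¹ * τ ∈ V.stab v ↔ V.act σ v = V.act τ v := by
  rw [mem_stab, act_mul]
  constructor
  · intro h
    rw [← V.act_act_inv σ (V.act τ v), h]
  · intro h
    rw [← h, act_inv_act]

theorem pairOrbit_eq_iff {n : ℕ} {x y z : V.obj n} :
    V.pairOrbit x y = V.pairOrbit x z ↔ ∃ σ : Equiv.Perm (Fin n), V.act σ y = z ∧ V.act σ x = x :=
  Quotient.eq (r := V.pairSetoid x)

theorem pairOrbit_act {n : ℕ} {x : V.obj n} {σ : Equiv.Perm (Fin n)} (hσ : V.act σ x = x)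
    (y : V.obj n) : V.pairOrbit x (V.act σ y) = V.pairOrbit x y :=
  (pairOrbit_eq_iff.2 ⟨σ, rfl, hσ⟩).symm

theorem eq_of_pairOrbit_self {n : ℕ} {x y : V.obj n} (h : V.pairOrbit x y = V.pairOrbit x x) :
    y = x := by
  obtain ⟨σ, hσ, hx⟩ := pairOrbit_eq_iff.1 h
  rw [← V.act_inv_act σ y, hσ]
  conv_lhs => rw [← hx]
  exact V.act_inv_act σ x

theorem pairOrbit_surjective {n : ℕ} (x : V.obj n) : Function.Surjective (V.pairOrbit x) :=
  Quotient.mk_surjective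

/-- The vertices of the orbit graphs `G_n^x` do not change for `n ≥ m`. -/
def OrbitsStable (V : FISet.{u}) {m : ℕ} (x : V.obj m) : Prop :=
  ∀ k : ℕ, Function.Bijective (V.orbitIncl x k)

section Stable

variable {m : ℕ} {x : V.obj m} (hb : V.OrbitsStable x)
include hb

theorem OrbitsStable.exists_rep {n : ℕ} (h : m ≤ n) (z : V.obj n) :
    ∃ y : V.obj m, V.pairOrbit (V.incl h x) (V.incl h y) = V.pairOrbit (V.incl h x) z := by
  obtain ⟨k, rfl⟩ := Nat.exists_eq_add_of_le h
  obtain ⟨a, ha⟩ := (hb k).2 (V.pairOrbit _ z)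
  obtain ⟨y, rfl⟩ := V.pairOrbit_surjective x a
  exact ⟨y, ha⟩

theorem OrbitsStable.pairOrbit_incl_iff_base {n : ℕ} (h : m ≤ n) (y z : V.obj m) :
    V.pairOrbit (V.incl h x) (V.incl h y) = V.pairOrbit (V.incl h x) (V.incl h z) ↔
      V.pairOrbit x y = V.pairOrbit x z := by
  obtain ⟨k, rfl⟩ := Nat.exists_eq_add_of_le h
  exact (hb k).1.eq_iff (a := V.pairOrbit x y) (b := V.pairOrbit x z)

omit hb in
theorem pairOrbit_incl {n N : ℕ} (h : m ≤ n) (h' : n ≤ N) {y z : V.obj n}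
    (hyz : V.pairOrbit (V.incl h x) y = V.pairOrbit (V.incl h x) z) :
    V.pairOrbit (V.incl (h.trans h') x) (V.incl h' y) =
      V.pairOrbit (V.incl (h.trans h') x) (V.incl h' z) := by
  obtain ⟨σ, rfl, hσ⟩ := pairOrbit_eq_iff.1 hyz
  obtain ⟨τ, hτ⟩ := exists_perm_extends h' σ
  refine pairOrbit_eq_iff.2 ⟨τ, act_incl_of_extends h' hτ y, ?_⟩
  rw [← incl_incl h h', act_incl_of_extends h' hτ, hσ]

theorem OrbitsStable.pairOrbit_incl_iff {n N : ℕ} (h : m ≤ n) (h' : n ≤ N) (y z : V.obj n) :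
    V.pairOrbit (V.incl (h.trans h') x) (V.incl h' y) =
      V.pairOrbit (V.incl (h.trans h') x) (V.incl h' z) ↔
    V.pairOrbit (V.incl h x) y = V.pairOrbit (V.incl h x) z := by
  refine ⟨fun hyz => ?_, pairOrbit_incl h h'⟩
  obtain ⟨y', hy'⟩ := hb.exists_rep h y
  obtain ⟨z', hz'⟩ := hb.exists_rep h z
  rw [← pairOrbit_incl h h' hy', ← pairOrbit_incl h h' hz', incl_incl, incl_incl,
    hb.pairOrbit_incl_iff_base] at hyz
  rw [← hy', ← hz', hb.pairOrbit_incl_iff_base, hyz]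

/-- The vertex `x(n)` is the only one that becomes `x(N)`. This is what makes the stabilizers of the
`x(n)` compatible with each other. -/
theorem OrbitsStable.eq_of_incl_eq {n N : ℕ} (h : m ≤ n) (h' : n ≤ N) {y : V.obj n}
    (hy : V.incl h' y = V.incl (h.trans h') x) : y = V.incl h x := by
  refine eq_of_pairOrbit_self ((hb.pairOrbit_incl_iff h h' _ _).1 ?_)
  rw [hy, incl_incl]

theorem OrbitsStable.mem_stab_iff_of_extends {n N : ℕ} (h : m ≤ n) (h' : n ≤ N)
    {σ : Equiv.Perm (Fin n)} {τ : Equiv.Perm (Fin N)}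
    (hτ : ∀ i, τ (Fin.castLE h' i) = Fin.castLE h' (σ i)) :
    τ ∈ V.stab (V.incl (h.trans h') x) ↔ σ ∈ V.stab (V.incl h x) := by
  rw [mem_stab, mem_stab, ← incl_incl h h', act_incl_of_extends h' hτ]
  refine ⟨fun hs => ?_, fun hs => by rw [hs]⟩
  exact hb.eq_of_incl_eq h h' (by rw [hs, incl_incl])

omit hb in
theorem swap_castLE {n N : ℕ} (h : n ≤ N) (i j k : Fin n) :
    Equiv.swap (Fin.castLE h i) (Fin.castLE h j) (Fin.castLE h k) =
      Fin.castLE h (Equiv.swap i j k) :=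
  ((Fin.castLEEmb h).swap_apply i j k)

omit hb in
theorem mem_stab_of_fixes_lt {n : ℕ} (h : m ≤ n) {σ : Equiv.Perm (Fin n)}
    (hσ : ∀ i : Fin n, (i : ℕ) < m → σ i = i) : σ ∈ V.stab (V.incl h x) :=
  act_incl_of_fixes h (fun i => hσ _ i.2) x

omit hb in
theorem swap_mem_trans {n : ℕ} {K : Subgroup (Equiv.Perm (Fin n))} {i j k : Fin n}
    (h1 : Equiv.swap i j ∈ K) (h2 : Equiv.swap j k ∈ K) : Equiv.swap i k ∈ K := by
  by_cases hij : i = j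
  · rwa [hij]
  by_cases hik : i = k
  · rw [hik, Equiv.swap_self]; exact K.one_mem
  rw [Equiv.swap_comm, ← Equiv.swap_mul_swap_mul_swap hij hik]
  exact mul_mem (mul_mem h2 h1) h2

/-- Whether the transposition of `i ∈ [m]` with a point outside `[m]` fixes `x(n)` depends neither
on that point nor on `n`. -/
theorem OrbitsStable.swap_mem_stab {n n' : ℕ} (h : m ≤ n) (h' : m ≤ n') {i j : Fin n}
    {i' j' : Fin n'} (hi : (i : ℕ) = i') (hj : m ≤ j) (hj' : m ≤ j')
    (hs : Equiv.swap i j ∈ V.stab (V.incl h x)) :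
    Equiv.swap i' j' ∈ V.stab (V.incl h' x) := by
  have hl := le_max_left n n'
  have hr := le_max_right n n'
  rw [← hb.mem_stab_iff_of_extends h hl (swap_castLE hl i j)] at hs
  rw [← hb.mem_stab_iff_of_extends h' hr (swap_castLE hr i' j')]
  have hii : Fin.castLE hl i = Fin.castLE hr i' := Fin.ext hi
  rw [hii] at hs
  refine swap_mem_trans hs (mem_stab_of_fixes_lt _ fun k hk => ?_)
  refine Equiv.swap_apply_of_ne_of_ne ?_ ?_
  · rintro rfl; simp at hk; omega
  · rintro rfl; simp at hk; omega

open Classical in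
/-- The support of `x`: the points of `[m]` whose transposition with a point outside `[m]` moves
some `x(n)`. It is a set of natural numbers, so as to be comparable with points of every `[n]`. -/
noncomputable def supp (V : FISet.{u}) {m : ℕ} (x : V.obj m) : Finset ℕ :=
  (Finset.range m).filter fun i => ∃ (n : ℕ) (h : m ≤ n) (i' j : Fin n), (i' : ℕ) = i ∧ m ≤ j ∧
    Equiv.swap i' j ∉ V.stab (V.incl h x)

omit hb in
theorem lt_of_mem_supp {i : ℕ} (hi : i ∈ V.supp x) : i < m := by
  classical exact Finset.mem_range.1 (Finset.mem_filter.1 hi).1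

omit hb in
theorem card_supp_le : (V.supp x).card ≤ m := by
  simpa using Finset.card_le_card (t := Finset.range m)
    fun i hi => Finset.mem_range.2 (lt_of_mem_supp (x := x) hi)

theorem OrbitsStable.swap_mem_stab_iff {n : ℕ} (h : m ≤ n) {i j : Fin n} (hj : m ≤ j) :
    Equiv.swap i j ∈ V.stab (V.incl h x) ↔ (i : ℕ) ∉ V.supp x := by
  classical
  constructor
  · intro hs hi
    obtain ⟨-, n', h', i', j', hii, hj', hs'⟩ := Finset.mem_filter.1 hi
    exact hs' (hb.swap_mem_stab h h' hii.symm hj hj' hs)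
  · intro hi
    by_cases him : (i : ℕ) < m
    · by_contra hs
      exact hi (Finset.mem_filter.2 ⟨Finset.mem_range.2 him, n, h, i, j, rfl, hj, hs⟩)
    · refine mem_stab_of_fixes_lt _ fun k hk => Equiv.swap_apply_of_ne_of_ne ?_ ?_
      · rintro rfl; omega
      · rintro rfl; omega

theorem OrbitsStable.swap_mem_stab_of_notMem {n : ℕ} (h : m ≤ n) {i j : Fin n}
    (hi : (i : ℕ) ∉ V.supp x) (hj : (j : ℕ) ∉ V.supp x) :
    Equiv.swap i j ∈ V.stab (V.incl h x) := by
  have h' := Nat.le_succ n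
  rw [← hb.mem_stab_iff_of_extends h h' (swap_castLE h' i j)]
  refine swap_mem_trans (j := Fin.last n) ?_ ?_
  · exact (hb.swap_mem_stab_iff _ (by simpa using h)).2 hi
  · rw [Equiv.swap_comm]
    exact (hb.swap_mem_stab_iff _ (by simpa using h)).2 hj

theorem OrbitsStable.swap_notMem_stab {n : ℕ} (h : m ≤ n) {i j : Fin n}
    (hi : (i : ℕ) ∈ V.supp x) (hj : (j : ℕ) ∉ V.supp x) :
    Equiv.swap i j ∉ V.stab (V.incl h x) := by
  intro hs
  have h' := Nat.le_succ n
  rw [← hb.mem_stab_iff_of_extends h h' (swap_castLE h' i j)] at hs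
  refine (hb.swap_mem_stab_iff (h.trans h') (i := Fin.castLE h' i) (j := Fin.last n)
    (by simpa using h)).1 (swap_mem_trans hs ?_) hi
  exact (hb.swap_mem_stab_iff _ (by simpa using h)).2 hj

theorem OrbitsStable.mem_stab_of_fixes_supp {n : ℕ} (h : m ≤ n) {σ : Equiv.Perm (Fin n)}
    (hσ : ∀ i : Fin n, (i : ℕ) ∈ V.supp x → σ i = i) : σ ∈ V.stab (V.incl h x) :=
  Equiv.Perm.mem_of_swap_mem _ {i : Fin n | (i : ℕ) ∉ V.supp x}
    (fun _ hi _ hj => hb.swap_mem_stab_of_notMem h hi hj) σ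
    (fun i hi => hσ i (not_not.1 hi))

omit hb in
/-- A permutation of `[n]` keeps some point of `[n] \ [m]` outside a small set. -/
theorem exists_apply_notMem {n : ℕ} (A : Finset ℕ) (hA : m + A.card < n)
    (σ : Equiv.Perm (Fin n)) : ∃ j : Fin n, m ≤ j ∧ (σ j : ℕ) ∉ A := by
  by_contra! hc
  have hsub : (Finset.univ : Finset (Fin n)).image (fun j : Fin n => if (j : ℕ) < m then
      (Sum.inl (j : ℕ) : ℕ ⊕ ℕ) else Sum.inr (σ j)) ⊆ (Finset.range m).disjSum A := by
    intro s hs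
    obtain ⟨j, -, rfl⟩ := Finset.mem_image.1 hs
    split_ifs with hj
    · simpa using hj
    · simpa using hc j (not_lt.1 hj)
  have hcard := Finset.card_le_card hsub
  rw [Finset.card_image_of_injective, Finset.card_univ, Fintype.card_fin, Finset.card_disjSum,
    Finset.card_range] at hcard
  · omega
  · intro j j' hjj
    dsimp only at hjj
    split_ifs at hjj
    · exact Fin.ext (Sum.inl_injective hjj)
    · exact σ.injective (Fin.ext (Sum.inr_injective hjj))

theorem OrbitsStable.apply_mem_supp {n : ℕ} (h : m ≤ n) {σ : Equiv.Perm (Fin n)}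
    (hσ : σ ∈ V.stab (V.incl h x)) {i : Fin n} (hi : (i : ℕ) ∈ V.supp x) :
    (σ i : ℕ) ∈ V.supp x := by
  have h' : n ≤ n + 2 * m + 1 := by omega
  obtain ⟨τ, hτ⟩ := exists_perm_extends h' σ
  rw [← hb.mem_stab_iff_of_extends h h' hτ] at hσ
  by_contra hc
  obtain ⟨j, hj, hj'⟩ := exists_apply_notMem (m := m) (V.supp x)
    (by have := card_supp_le (x := x); omega) τ
  have hsw : Equiv.swap (τ (Fin.castLE h' i)) (τ j) ∈ V.stab (V.incl (h.trans h') x) :=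
    hb.swap_mem_stab_of_notMem _ (by rw [hτ]; exact hc) hj'
  have hconj := mul_mem (mul_mem (inv_mem hσ) hsw) hσ
  rw [mul_assoc, Equiv.swap_mul_eq_mul_swap, inv_mul_cancel_left,
    Equiv.Perm.inv_def, Equiv.symm_apply_apply, Equiv.symm_apply_apply] at hconj
  exact (hb.swap_mem_stab_iff (i := Fin.castLE h' i) _ hj).1 hconj hi

end Stable

end FISet

/-! ### Structure of the vertex sets -/

namespace FISet

variable {V : FISet.{u}}

section Stable

variable {m : ℕ} {x : V.obj m}

/-- Vertices of `V_n` are moved to each other already in the range where the orbits are stable: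
a permutation `τ` of `[N]` moving `x(N)` to `y(N)` maps the support of `x` into `[n]`, because
transpositions of points outside `[n]` fix `y(N)`. -/
theorem OrbitsStable.exists_act_eq (hb : V.OrbitsStable x)
    (htr : ∀ᶠ n in atTop, ∀ v w : V.obj n, ∃ σ : Equiv.Perm (Fin n), V.act σ v = w)
    {n : ℕ} (h : m ≤ n) (y : V.obj n) :
    ∃ σ : Equiv.Perm (Fin n), V.act σ (V.incl h x) = y := by
  obtain ⟨N, hN, hNn⟩ := (htr.and (eventually_ge_atTop (n + m + 1))).exists
  have h' : n ≤ N := by omega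
  obtain ⟨τ, hτ⟩ := hN (V.incl (h.trans h') x) (V.incl h' y)
  have hlt : ∀ i : Fin N, (i : ℕ) ∈ V.supp x → (τ i : ℕ) < n := by
    intro i hi
    by_contra hc
    obtain ⟨j, hj, hj'⟩ := exists_apply_notMem (m := n) (V.supp x)
      (by have := card_supp_le (x := x); omega) τ⁻¹
    have hfix : V.act (Equiv.swap (τ i) j) (V.incl h' y) = V.incl h' y := by
      refine act_incl_of_fixes h' (fun k => Equiv.swap_apply_of_ne_of_ne ?_ ?_) y
      · intro hk
        have := k.2
        rw [← hk] at hc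
        exact hc this
      · rintro rfl
        exact absurd k.2 (not_lt.2 hj)
    rw [← hτ, ← act_mul, Eq.comm, ← inv_mul_mem_stab, Equiv.swap_mul_eq_mul_swap,
      inv_mul_cancel_left, Equiv.Perm.inv_def, Equiv.symm_apply_apply] at hfix
    exact hb.swap_notMem_stab _ hi hj' hfix
  let f : {i // i ∈ V.supp x} ↪ Fin n :=
    ⟨fun i => ⟨i, (lt_of_mem_supp i.2).trans_le h⟩, fun i j hij =>
      Subtype.ext (Fin.val_eq_of_eq hij)⟩
  let g : {i // i ∈ V.supp x} ↪ Fin n :=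
    ⟨fun i => ⟨τ (Fin.castLE h' (f i)), hlt _ i.2⟩, fun i j hij => by
      have := Fin.val_eq_of_eq hij
      have := τ.injective (Fin.ext this)
      exact f.injective (Fin.castLE_injective h' this)⟩
  obtain ⟨σ, hσ⟩ := exists_perm_extending f g
  obtain ⟨ρ, hρ⟩ := exists_perm_extends h' σ
  have hρτ : V.act ρ (V.incl (h.trans h') x) = V.incl h' y := by
    rw [← hτ, Eq.comm, ← inv_mul_mem_stab]
    refine hb.mem_stab_of_fixes_supp _ fun i hi => ?_
    have h1 := hρ (f ⟨i, hi⟩)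
    rw [hσ] at h1
    have h2 : Fin.castLE h' (f ⟨i, hi⟩) = i := rfl
    have h3 : Fin.castLE h' (g ⟨i, hi⟩) = τ i := rfl
    rw [h2, h3] at h1
    rw [Equiv.Perm.mul_apply, h1, Equiv.Perm.inv_def, Equiv.symm_apply_apply]
  refine ⟨σ, ?_⟩
  have hρ' : ∀ i, ρ⁻¹ (Fin.castLE h' i) = Fin.castLE h' (σ⁻¹ i) := fun i => by
    rw [Equiv.Perm.inv_eq_iff_eq, hρ, Equiv.Perm.inv_def, Equiv.apply_symm_apply]
  have hy : V.act σ⁻¹ y = V.incl h x := by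
    refine hb.eq_of_incl_eq h h' ?_
    rw [← act_incl_of_extends h' hρ', ← hρτ, act_inv_act]
  rw [← hy, act_act_inv]

/-- `x` is *supported* on the points `e 0, …, e (d - 1)` with symmetry `H ≤ 𝔖_d`: for every `n ≥ m`
the group `𝔖_n` acts transitively on `V_n`, and the stabilizer of `x(n)` consists of the
permutations that preserve the support and act on it through `H`. Moreover `[m]` has room for a
second, disjoint support. -/
structure IsSupported (V : FISet.{u}) {m d : ℕ} (x : V.obj m) (e : Fin d ↪ Fin m)
    (H : Subgroup (Equiv.Perm (Fin d))) : Prop where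
  mem_stab_iff : ∀ {n : ℕ} (h : m ≤ n) (σ : Equiv.Perm (Fin n)),
    σ ∈ V.stab (V.incl h x) ↔ ∃ g ∈ H, ∀ i, σ (Fin.castLE h (e i)) = Fin.castLE h (e (g i))
  exists_act_eq : ∀ {n : ℕ} (h : m ≤ n) (y : V.obj n),
    ∃ σ : Equiv.Perm (Fin n), V.act σ (V.incl h x) = y
  two_mul_le : 2 * d ≤ m

theorem OrbitsStable.exists_isSupported (hb : V.OrbitsStable x)
    (htr : ∀ᶠ n in atTop, ∀ v w : V.obj n, ∃ σ : Equiv.Perm (Fin n), V.act σ v = w) :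
    ∃ (d : ℕ) (e : Fin d ↪ Fin m) (H : Subgroup (Equiv.Perm (Fin d))), V.IsSupported x e H := by
  let d := (V.supp x).card
  let e' := (V.supp x).orderEmbOfFin (rfl : _ = d)
  have he' : ∀ i, e' i ∈ V.supp x := fun i => Finset.orderEmbOfFin_mem _ _ i
  let e : Fin d ↪ Fin m := ⟨fun i => ⟨e' i, lt_of_mem_supp (he' i)⟩, fun i j hij =>
    e'.injective (Fin.val_eq_of_eq hij)⟩
  have he : ∀ i, (e i : ℕ) ∈ V.supp x := he'
  have hsurj : ∀ i ∈ V.supp x, ∃ j, (e j : ℕ) = i := fun i hi => by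
    have : i ∈ Set.range e' := by
      rw [Finset.range_orderEmbOfFin]; exact hi
    exact this
  -- Membership in the stabilizer depends only on the restriction to the support.
  have hfix : ∀ {n : ℕ} (h : m ≤ n) {σ τ : Equiv.Perm (Fin n)},
      (∀ i, σ (Fin.castLE h (e i)) = τ (Fin.castLE h (e i))) →
      (σ ∈ V.stab (V.incl h x) ↔ τ ∈ V.stab (V.incl h x)) := by
    intro n h σ τ hst
    have : σ⁻¹ * τ ∈ V.stab (V.incl h x) := by
      refine hb.mem_stab_of_fixes_supp h fun i hi => ?_
      obtain ⟨j, hj⟩ := hsurj i hi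
      have : i = Fin.castLE h (e j) := Fin.ext hj.symm
      rw [this, Equiv.Perm.mul_apply, ← hst, Equiv.Perm.inv_def, Equiv.symm_apply_apply]
    refine ⟨fun hσ => ?_, fun hτ => ?_⟩
    · simpa using mul_mem hσ this
    · simpa using mul_mem hτ (inv_mem this)
  -- Level independence: `σ` and `σ'` at levels `n`, `n'` inducing the same permutation of the
  -- support are compared at a common level.
  have hlev : ∀ {n n' : ℕ} (h : m ≤ n) (h' : m ≤ n') {σ : Equiv.Perm (Fin n)}
      {σ' : Equiv.Perm (Fin n')} (g : Equiv.Perm (Fin d)),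
      (∀ i, σ (Fin.castLE h (e i)) = Fin.castLE h (e (g i))) →
      (∀ i, σ' (Fin.castLE h' (e i)) = Fin.castLE h' (e (g i))) →
      σ ∈ V.stab (V.incl h x) → σ' ∈ V.stab (V.incl h' x) := by
    intro n n' h h' σ σ' g hσ hσ' hs
    have hl := le_max_left n n'
    have hr := le_max_right n n'
    obtain ⟨τ, hτ⟩ := exists_perm_extends hl σ
    obtain ⟨τ', hτ'⟩ := exists_perm_extends hr σ'
    rw [← hb.mem_stab_iff_of_extends h hl hτ] at hs
    rw [← hb.mem_stab_iff_of_extends h' hr hτ']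
    refine (hfix (h.trans hl) fun i => ?_).1 hs
    have h1 := hτ (Fin.castLE h (e i))
    have h2 := hτ' (Fin.castLE h' (e i))
    rw [hσ] at h1
    rw [hσ'] at h2
    exact h1.trans h2.symm
  have hext : ∀ {n : ℕ} (h : m ≤ n) (g : Equiv.Perm (Fin d)), ∃ σ : Equiv.Perm (Fin n),
      ∀ i, σ (Fin.castLE h (e i)) = Fin.castLE h (e (g i)) := fun h g =>
    exists_perm_extending (e.trans (Fin.castLEEmb h))
      (g.toEmbedding.trans (e.trans (Fin.castLEEmb h)))
  let H : Subgroup (Equiv.Perm (Fin d)) :=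
    { carrier := {g | ∀ {n : ℕ} (h : m ≤ n) (σ : Equiv.Perm (Fin n)),
        (∀ i, σ (Fin.castLE h (e i)) = Fin.castLE h (e (g i))) → σ ∈ V.stab (V.incl h x)}
      one_mem' := fun h σ hσ => (hfix h (σ := 1) (fun i => (hσ i).symm)).1 (one_mem _)
      mul_mem' := fun {g g'} hg hg' n h σ hσ => by
        obtain ⟨τ, hτ⟩ := hext h g
        obtain ⟨τ', hτ'⟩ := hext h g'
        refine (hfix h (σ := τ * τ') fun i => ?_).1 (mul_mem (hg h τ hτ) (hg' h τ' hτ'))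
        rw [hσ, Equiv.Perm.mul_apply, hτ', hτ]; rfl
      inv_mem' := fun {g} hg n h σ hσ => by
        rw [← inv_mem_iff]
        refine hg h σ⁻¹ fun i => ?_
        rw [Equiv.Perm.inv_eq_iff_eq, hσ]
        simp }
  have hstab : ∀ {n : ℕ} (h : m ≤ n) (σ : Equiv.Perm (Fin n)), σ ∈ V.stab (V.incl h x) ↔
      ∃ g ∈ H, ∀ i, σ (Fin.castLE h (e i)) = Fin.castLE h (e (g i)) := by
    intro n h σ
    refine ⟨fun hσ => ?_, fun ⟨g, hg, hgσ⟩ => hg h σ hgσ⟩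
    have hex : ∀ i, ∃ j, Fin.castLE h (e j) = σ (Fin.castLE h (e i)) := fun i => by
      obtain ⟨j, hj⟩ := hsurj _ (hb.apply_mem_supp h hσ (i := Fin.castLE h (e i)) (he i))
      exact ⟨j, Fin.ext hj⟩
    choose g hg using hex
    have hginj : Function.Injective g := fun i j hij => by
      have := hg i
      rw [hij, hg j] at this
      exact e.injective (Fin.castLE_injective h (σ.injective this.symm))
    refine ⟨Equiv.ofBijective g (Finite.injective_iff_bijective.1 hginj), ?_, fun i => (hg i).symm⟩
    intro n' h' σ' hσ'
    exact hlev h h' _ (fun i => (hg i).symm) hσ' hσ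
  refine ⟨d, e, H, hstab, hb.exists_act_eq htr, ?_⟩
  -- A vertex of `V_{2m}` whose support is disjoint from that of `x(2m)` is represented in `V_m`.
  have h' : m ≤ m + m := Nat.le_add_right m m
  obtain ⟨τ, hτ⟩ := exists_perm_extending (Fin.castLEEmb h') (Fin.natAddEmb m)
  obtain ⟨y, hy⟩ := hb.exists_rep h' (V.act τ (V.incl h' x))
  obtain ⟨σ, rfl⟩ := hb.exists_act_eq htr le_rfl y
  rw [incl_refl] at hy
  obtain ⟨σ', hσ'⟩ := exists_perm_extends h' σ
  obtain ⟨ρ, hρ, hρx⟩ := pairOrbit_eq_iff.1 hy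
  rw [← act_incl_of_extends h' hσ', ← act_mul, Eq.comm, ← inv_mul_mem_stab] at hρ
  have hdisj : ∀ i j, σ (e i) ≠ e j := by
    intro i j hij
    have h1 : (σ' (Fin.castLE h' (e i)) : ℕ) ∈ V.supp x := by
      rw [hσ', hij]; exact he j
    have h2 := hb.apply_mem_supp h' (mem_stab.2 hρx) h1
    have h3 := hb.apply_mem_supp h' hρ (i := Fin.castLE h' (e i)) (he i)
    have h4 : τ ((τ⁻¹ * (ρ * σ')) (Fin.castLE h' (e i))) = ρ (σ' (Fin.castLE h' (e i))) := by
      simp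
    rw [← h4] at h2
    have h5 := hτ ⟨_, lt_of_mem_supp h3⟩
    have h6 : Fin.castLEEmb h' ⟨_, lt_of_mem_supp h3⟩ = (τ⁻¹ * (ρ * σ')) (Fin.castLE h' (e i)) := rfl
    rw [h6] at h5
    rw [h5] at h2
    have h7 := lt_of_mem_supp h2
    simp at h7
  have hinj : Function.Injective (Sum.elim e (e.trans σ.toEmbedding)) :=
    e.injective.sumElim (e.trans σ.toEmbedding).injective fun j i hij => hdisj i j hij.symm
  have := Fintype.card_le_of_injective _ hinj
  simp at this
  omega

end Stable

end FISet

/-! ### Parametrization by supports and polynomial counts -/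

section Trace

/-- The part of an embedding `[d] → [n]` that is visible in `[m]`. -/
def Fin.trace (m : ℕ) {d n : ℕ} (f : Fin d ↪ Fin n) (i : Fin d) : Option (Fin m) :=
  if h : (f i : ℕ) < m then some ⟨f i, h⟩ else none

variable {m d n : ℕ}

theorem Fin.trace_eq_none {f : Fin d ↪ Fin n} {i : Fin d} :
    Fin.trace m f i = none ↔ m ≤ (f i : ℕ) := by
  simp [Fin.trace]

theorem Fin.trace_eq_some {f : Fin d ↪ Fin n} {i : Fin d} {a : Fin m} :
    Fin.trace m f i = some a ↔ (f i : ℕ) = a := by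
  unfold Fin.trace
  split_ifs with h
  · simp [Fin.ext_iff]
  · simp only [false_iff]
    have := a.2
    omega

theorem Fin.trace_trans_castLE {N : ℕ} (h : n ≤ N) (f : Fin d ↪ Fin n) :
    Fin.trace m (f.trans (Fin.castLEEmb h)) = Fin.trace m f := rfl

/-- Embeddings with the same trace differ by a permutation that fixes `[m]` pointwise. -/
theorem Fin.exists_perm_of_trace_eq (h : m ≤ n) {f f' : Fin d ↪ Fin n}
    (hff : Fin.trace m f = Fin.trace m f') : ∃ σ : Equiv.Perm (Fin n),
      (∀ i, σ (Fin.castLE h i) = Fin.castLE h i) ∧ f.trans σ.toEmbedding = f' := by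
  have hinj : ∀ g : Fin d ↪ Fin n, (∀ i, Fin.trace m f i = none → m ≤ (g i : ℕ)) →
      Function.Injective (Sum.elim (Fin.castLE h) (fun i : {i // Fin.trace m f i = none} => g i)) :=
    fun g hg => (Fin.castLE_injective h).sumElim
      (g.injective.comp Subtype.val_injective) fun a i hai => by
        have h1 := hg i i.2
        have h2 := Fin.val_eq_of_eq hai
        have h3 := a.2
        simp only [Fin.val_castLE] at h2
        omega
  obtain ⟨σ, hσ⟩ := exists_perm_extending ⟨_, hinj f fun i hi => Fin.trace_eq_none.1 hi⟩
    ⟨_, hinj f' fun i hi => Fin.trace_eq_none.1 (hff ▸ hi)⟩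
  have h1 : ∀ i, σ (Fin.castLE h i) = Fin.castLE h i := fun i => hσ (Sum.inl i)
  refine ⟨σ, h1, ?_⟩
  ext i : 1
  rcases hi : Fin.trace m f i with _ | a
  · exact hσ (Sum.inr ⟨i, hi⟩)
  · have h2 : f i = Fin.castLE h a := Fin.ext (Fin.trace_eq_some (m := m).1 hi)
    have h3 : f' i = Fin.castLE h a := Fin.ext (Fin.trace_eq_some (m := m).1 (hff ▸ hi))
    change σ (f i) = f' i
    rw [h2, h3, h1]

open Classical in
/-- An embedding with trace `t` amounts to an injection into `[m+k] \ [m]` of the points where `t`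
is undefined, so the number of such embeddings is a falling factorial in `k`. -/
theorem Fin.exists_poly_card_trace (t : Fin d → Option (Fin m)) :
    ∃ p : Polynomial ℝ, ∀ k : ℕ,
      p.eval (k : ℝ) = (Finset.univ.filter
        fun f : Fin d ↪ Fin (m + k) => Fin.trace m f = t).card := by
  by_cases ht : ∃ (n : ℕ) (f : Fin d ↪ Fin n), Fin.trace m f = t
  · obtain ⟨n, f₀, hf₀⟩ := ht
    refine ⟨descPochhammer ℝ (Fintype.card {i // t i = none}), fun k => ?_⟩
    rw [descPochhammer_eval_eq_descFactorial, ← Fintype.card_subtype]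
    norm_cast
    have hc : Fintype.card ({i // t i = none} ↪ Fin k) =
        k.descFactorial (Fintype.card {i // t i = none}) := by
      rw [Fintype.card_embedding_eq, Fintype.card_fin]
    rw [← hc, Eq.comm]
    have hnone : ∀ f : {f : Fin d ↪ Fin (m + k) // Fin.trace m f = t}, ∀ i, t i = none →
        m ≤ (f.1 i : ℕ) := fun f i hi => Fin.trace_eq_none.1 (by rw [f.2, hi])
    let F : {f : Fin d ↪ Fin (m + k) // Fin.trace m f = t} → ({i // t i = none} ↪ Fin k) :=
      fun f => ⟨fun i => ⟨f.1 i - m, by have := hnone f i i.2; have := (f.1 i).2; omega⟩,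
        fun i j hij => by
          have h1 := hnone f i i.2
          have h2 := hnone f j j.2
          have h3 : (f.1 i : ℕ) - m = f.1 j - m := Fin.val_eq_of_eq hij
          exact Subtype.ext (f.1.injective (Fin.ext (by omega)))⟩
    refine Fintype.card_of_bijective (f := F) ⟨fun f f' hff => ?_, fun g => ?_⟩
    · refine Subtype.ext (Function.Embedding.ext fun i => Fin.ext ?_)
      rcases hi : t i with _ | a
      · have h1 := hnone f i hi
        have h2 := hnone f' i hi
        have h3 : (f.1 i : ℕ) - m = f'.1 i - m :=
          Fin.val_eq_of_eq (DFunLike.congr_fun hff ⟨i, hi⟩)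
        omega
      · rw [Fin.trace_eq_some.1 (by rw [f.2, hi]), Fin.trace_eq_some.1 (by rw [f'.2, hi])]
    · let φ : Fin d → Fin (m + k) := fun i =>
        if h : t i = none then Fin.natAdd m (g ⟨i, h⟩)
        else Fin.castAdd k ((t i).get (Option.isSome_iff_ne_none.2 h))
      have hφn : ∀ i (h : t i = none), φ i = Fin.natAdd m (g ⟨i, h⟩) := fun i h => dif_pos h
      have hφs : ∀ i a, t i = some a → φ i = Fin.castAdd k a := fun i a h => by
        simp [φ, h]
      have hφ : Function.Injective φ := by
        intro i j hij
        rcases hi : t i with _ | a <;> rcases hj : t j with _ | b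
        · rw [hφn i hi, hφn j hj] at hij
          have := g.injective ((Fin.natAddEmb m).injective hij)
          simpa using this
        · rw [hφn i hi, hφs j b hj] at hij
          have h1 := Fin.val_eq_of_eq hij
          simp at h1
          have := b.2
          omega
        · rw [hφs i a hi, hφn j hj] at hij
          have h1 := Fin.val_eq_of_eq hij
          simp at h1
          have := a.2
          omega
        · rw [hφs i a hi, hφs j b hj] at hij
          have hab : a = b := (Fin.castAddEmb k).injective hij
          refine f₀.injective (Fin.ext ?_)
          rw [Fin.trace_eq_some.1 (by rw [hf₀, hi]), Fin.trace_eq_some.1 (by rw [hf₀, hj]), hab]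
      have hφt : Fin.trace m ⟨φ, hφ⟩ = t := by
        funext i
        rcases hi : t i with _ | a
        · refine Fin.trace_eq_none.2 ?_
          change m ≤ (φ i : ℕ)
          rw [hφn i hi]; simp
        · refine Fin.trace_eq_some.2 ?_
          change (φ i : ℕ) = a
          rw [hφs i a hi]; simp
      refine ⟨⟨⟨φ, hφ⟩, hφt⟩, Function.Embedding.ext fun i => Fin.ext ?_⟩
      change (φ i : ℕ) - m = g i
      rw [hφn i i.2]; simp
  · refine ⟨0, fun k => ?_⟩
    rw [Finset.filter_false_of_mem fun f _ hf => ht ⟨_, f, hf⟩]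
    simp

end Trace

namespace FISet

variable {V : FISet.{u}} {m d n : ℕ} {x : V.obj m} {e : Fin d ↪ Fin m}
  {H : Subgroup (Equiv.Perm (Fin d))}

/-- The vertex of `V_n` with support `f`: the image of `x(n)` under a permutation that moves the
support `e` of `x` to `f`. -/
noncomputable def vert (V : FISet.{u}) (x : V.obj m) (e : Fin d ↪ Fin m) (h : m ≤ n)
    (f : Fin d ↪ Fin n) : V.obj n :=
  V.act (Classical.choose (exists_perm_extending (e.trans (Fin.castLEEmb h)) f)) (V.incl h x)

namespace IsSupported

section

variable (hs : V.IsSupported x e H)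
include hs

theorem act_incl (h : m ≤ n) {f : Fin d ↪ Fin n} {σ : Equiv.Perm (Fin n)}
    (hσ : ∀ i, σ (Fin.castLE h (e i)) = f i) : V.act σ (V.incl h x) = V.vert x e h f := by
  refine inv_mul_mem_stab.1 ((hs.mem_stab_iff h _).2 ⟨1, one_mem _, fun i => ?_⟩)
  have := Classical.choose_spec (exists_perm_extending (e.trans (Fin.castLEEmb h)) f) i
  rw [Equiv.Perm.mul_apply, Equiv.Perm.inv_eq_iff_eq]
  exact this.trans (hσ i).symm

theorem act_vert (h : m ≤ n) (f : Fin d ↪ Fin n) (τ : Equiv.Perm (Fin n)) :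
    V.act τ (V.vert x e h f) = V.vert x e h (f.trans τ.toEmbedding) := by
  obtain ⟨σ, hσ⟩ := exists_perm_extending (e.trans (Fin.castLEEmb h)) f
  rw [← hs.act_incl h hσ, ← act_mul]
  exact hs.act_incl h fun i => congrArg τ (hσ i)

theorem incl_vert {N : ℕ} (h : m ≤ n) (h' : n ≤ N) (f : Fin d ↪ Fin n) :
    V.incl h' (V.vert x e h f) = V.vert x e (h.trans h') (f.trans (Fin.castLEEmb h')) := by
  obtain ⟨σ, hσ⟩ := exists_perm_extending (e.trans (Fin.castLEEmb h)) f
  obtain ⟨τ, hτ⟩ := exists_perm_extends h' σ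
  rw [← hs.act_incl h hσ, ← act_incl_of_extends h' hτ, incl_incl]
  refine hs.act_incl _ fun i => (hτ (Fin.castLE h (e i))).trans ?_
  exact congrArg (Fin.castLE h') (hσ i)

theorem exists_vert_eq (h : m ≤ n) (v : V.obj n) : ∃ f, V.vert x e h f = v := by
  obtain ⟨σ, rfl⟩ := hs.exists_act_eq h v
  exact ⟨(e.trans (Fin.castLEEmb h)).trans σ.toEmbedding, (hs.act_incl h fun i => rfl).symm⟩

theorem vert_eq_iff (h : m ≤ n) (f f' : Fin d ↪ Fin n) :
    V.vert x e h f = V.vert x e h f' ↔ ∃ g ∈ H, ∀ i, f' i = f (g i) := by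
  obtain ⟨σ, hσ⟩ := exists_perm_extending (e.trans (Fin.castLEEmb h)) f
  obtain ⟨τ, hτ⟩ := exists_perm_extending (e.trans (Fin.castLEEmb h)) f'
  rw [← hs.act_incl h hσ, ← hs.act_incl h hτ, ← inv_mul_mem_stab, hs.mem_stab_iff]
  refine exists_congr fun g => and_congr_right fun _ => forall_congr' fun i => ?_
  have h1 := hσ (g i)
  have h2 := hτ i
  simp only [Function.Embedding.trans_apply, Fin.castLEEmb_apply] at h1 h2
  rw [Equiv.Perm.mul_apply, Equiv.Perm.inv_eq_iff_eq, h1, h2]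

theorem transitive (h : m ≤ n) (v w : V.obj n) : ∃ σ : Equiv.Perm (Fin n), V.act σ v = w := by
  obtain ⟨σ, rfl⟩ := hs.exists_act_eq h v
  obtain ⟨τ, rfl⟩ := hs.exists_act_eq h w
  exact ⟨τ * σ⁻¹, by rw [← act_mul, inv_mul_cancel_right]⟩

open Classical in
/-- Every vertex has `|H|` parametrizations of its support. -/
theorem card_filter_vert (h : m ≤ n) (p : V.obj n → Prop) :
    (Finset.univ.filter fun f : Fin d ↪ Fin n => p (V.vert x e h f)).card =
      (Finset.univ.filter p).card * Fintype.card H := by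
  rw [Finset.card_eq_sum_card_fiberwise (f := V.vert x e h) (t := Finset.univ.filter p)
    (fun f hf => by simpa using hf)]
  refine Finset.sum_const_nat fun v hv => ?_
  obtain ⟨f, rfl⟩ := hs.exists_vert_eq h v
  let F : H → (Fin d ↪ Fin n) := fun g => g.1.toEmbedding.trans f
  have hF : Function.Injective F := fun g g' hgg => by
    refine Subtype.ext (Equiv.ext fun i => f.injective ?_)
    exact DFunLike.congr_fun hgg i
  rw [← Finset.card_univ, ← Finset.card_image_of_injective _ hF]
  congr 1
  ext f'
  simp only [Finset.mem_filter, Finset.mem_univ, true_and, Finset.mem_image]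
  constructor
  · rintro ⟨-, h1⟩
    obtain ⟨g, hg, hgf⟩ := (hs.vert_eq_iff h f f').1 h1.symm
    exact ⟨⟨g, hg⟩, Function.Embedding.ext fun i => (hgf i).symm⟩
  · rintro ⟨g, rfl⟩
    have h1 := (hs.vert_eq_iff h f (F g)).2 ⟨g.1, g.2, fun _ => rfl⟩
    exact ⟨h1 ▸ (Finset.mem_filter.1 hv).2, h1.symm⟩

open Classical in
/-- The number of vertices with a property that is compatible with the inclusions and invariant
under the permutations fixing `[m]` pointwise is a polynomial in `n`: the property depends only on
the trace of the support in `[m]`. -/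
theorem exists_poly_card (R : ∀ n : ℕ, m ≤ n → V.obj n → Prop)
    (hincl : ∀ {n N : ℕ} (h : m ≤ n) (h' : n ≤ N) (y : V.obj n),
      R N (h.trans h') (V.incl h' y) ↔ R n h y)
    (hact : ∀ {n : ℕ} (h : m ≤ n) (σ : Equiv.Perm (Fin n)),
      (∀ i, σ (Fin.castLE h i) = Fin.castLE h i) → ∀ y, R n h y → R n h (V.act σ y)) :
    ∃ p : Polynomial ℝ, ∀ k : ℕ, p.eval (k : ℝ) =
      (Finset.univ.filter fun v : V.obj (m + k) => R _ (Nat.le_add_right m k) v).card := by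
  have hdep : ∀ {n n' : ℕ} (h : m ≤ n) (h' : m ≤ n') (f : Fin d ↪ Fin n) (f' : Fin d ↪ Fin n'),
      Fin.trace m f = Fin.trace m f' → R n h (V.vert x e h f) → R n' h' (V.vert x e h' f') := by
    intro n n' h h' f f' hff hR
    have hl := le_max_left n n'
    have hr := le_max_right n n'
    rw [← hincl h hl, hs.incl_vert h hl] at hR
    rw [← hincl h' hr, hs.incl_vert h' hr]
    rw [← Fin.trace_trans_castLE hl, ← Fin.trace_trans_castLE hr] at hff
    obtain ⟨σ, hσ, hσf⟩ := Fin.exists_perm_of_trace_eq (h.trans hl) hff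
    rw [← hσf, ← hs.act_vert]
    exact hact _ σ hσ _ hR
  choose p hp using fun t : Fin d → Option (Fin m) => Fin.exists_poly_card_trace t
  let T : Finset (Fin d → Option (Fin m)) := Finset.univ.filter fun t =>
    ∃ (n : ℕ) (h : m ≤ n) (f : Fin d ↪ Fin n), Fin.trace m f = t ∧ R n h (V.vert x e h f)
  refine ⟨Polynomial.C ((Fintype.card H : ℝ)⁻¹) * ∑ t ∈ T, p t, fun k => ?_⟩
  have hH : (Fintype.card H : ℝ) ≠ 0 := Nat.cast_ne_zero.2 Fintype.card_ne_zero
  have h1 := hs.card_filter_vert (Nat.le_add_right m k) (R _ (Nat.le_add_right m k))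
  rw [Finset.card_eq_sum_card_fiberwise (f := Fin.trace m) (t := T)
    (fun f hf => Finset.mem_filter.2
      ⟨Finset.mem_univ _, _, _, f, rfl, (Finset.mem_filter.1 hf).2⟩)] at h1
  have h2 : ∀ t ∈ T, (((Finset.univ.filter fun f : Fin d ↪ Fin (m + k) =>
      R _ (Nat.le_add_right m k) (V.vert x e (Nat.le_add_right m k) f)).filter
        fun f => Fin.trace m f = t).card : ℝ) = (p t).eval (k : ℝ) := by
    intro t ht
    obtain ⟨-, n, h, f₀, hf₀, hR⟩ := Finset.mem_filter.1 ht
    rw [hp, Finset.filter_filter]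
    congr 2
    ext f
    simp only [Finset.mem_filter, Finset.mem_univ, true_and, and_iff_right_iff_imp]
    exact fun hf => hdep _ _ f₀ f (hf₀.trans hf.symm) hR
  have h3 := congrArg (Nat.cast (R := ℝ)) h1
  rw [Nat.cast_sum, Finset.sum_congr rfl h2, Nat.cast_mul] at h3
  rw [Polynomial.eval_mul, Polynomial.eval_C, Polynomial.eval_finsetSum, h3,
    mul_comm (Nat.cast _), inv_mul_cancel_left₀ hH]

/-- The vertices whose support is disjoint from that of `x(n)` form one orbit. -/
theorem pairOrbit_vert_eq_iff (h : m ≤ n) {f : Fin d ↪ Fin n}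
    (hf : ∀ i j, f i ≠ Fin.castLE h (e j)) (f' : Fin d ↪ Fin n) :
    V.pairOrbit (V.incl h x) (V.vert x e h f) = V.pairOrbit (V.incl h x) (V.vert x e h f') ↔
      ∀ i j, f' i ≠ Fin.castLE h (e j) := by
  constructor
  · intro hff i j hij
    obtain ⟨σ, hσ, hσx⟩ := pairOrbit_eq_iff.1 hff
    rw [hs.act_vert, hs.vert_eq_iff] at hσ
    obtain ⟨g, -, hg⟩ := hσ
    obtain ⟨g', -, hg'⟩ := (hs.mem_stab_iff h σ).1 hσx
    refine hf (g i) (g'.symm j) (σ.injective ?_)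
    rw [hg', Equiv.apply_symm_apply, ← hij, hg]
    rfl
  · intro hf'
    have hinj : ∀ f : Fin d ↪ Fin n, (∀ i j, f i ≠ Fin.castLE h (e j)) →
        Function.Injective (Sum.elim (fun i => Fin.castLE h (e i)) f) := fun f hf =>
      ((Fin.castLE_injective h).comp e.injective).sumElim f.injective fun i j => (hf j i).symm
    obtain ⟨σ, hσ⟩ := exists_perm_extending ⟨_, hinj f hf⟩ ⟨_, hinj f' hf'⟩
    refine pairOrbit_eq_iff.2 ⟨σ, ?_, ?_⟩
    · rw [hs.act_vert]
      congr 1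
      ext i : 1
      exact hσ (Sum.inr i)
    · exact (hs.mem_stab_iff h σ).2 ⟨1, one_mem _, fun i => hσ (Sum.inl i)⟩

end

end IsSupported

end FISet

/-! ### Labels -/

namespace FISet

theorem mk_eq_mk_blockSubgroup_iff {d n : ℕ} (hd : d ≤ n) (H : Subgroup (Equiv.Perm (Fin d)))
    (σ τ : Equiv.Perm (Fin n)) :
    (QuotientGroup.mk σ : Equiv.Perm (Fin n) ⧸ blockSubgroup hd H) = QuotientGroup.mk τ ↔
      ∃ g ∈ H, ∀ i, τ (Fin.castLE hd i) = σ (Fin.castLE hd (g i)) := by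
  rw [QuotientGroup.eq]
  refine exists_congr fun g => and_congr_right fun _ => forall_congr' fun i => ?_
  rw [Equiv.Perm.mul_apply, Equiv.Perm.inv_eq_iff_eq]

theorem mem_label_mk {d n : ℕ} (hd : d ≤ n) (H : Subgroup (Equiv.Perm (Fin d)))
    (σ : Equiv.Perm (Fin n)) (a : Fin d) (t : Fin n) :
    t ∈ label hd H (QuotientGroup.mk σ) a ↔
      ∃ b ∈ MulAction.orbit H a, σ (Fin.castLE hd b) = t := by
  constructor
  · rintro ⟨τ, hτ, b, hb, rfl⟩
    obtain ⟨g, hg, hgτ⟩ := (mk_eq_mk_blockSubgroup_iff hd H σ τ).1 hτ.symm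
    refine ⟨g b, ?_, (hgτ b).symm⟩
    rw [← MulAction.orbit_eq_iff] at hb
    rw [← hb]
    exact ⟨⟨g, hg⟩, rfl⟩
  · rintro ⟨b, hb, rfl⟩
    exact ⟨σ, rfl, b, hb, rfl⟩

variable {V : FISet.{u}} {m d : ℕ} {x : V.obj m} {e : Fin d ↪ Fin m}
  {H : Subgroup (Equiv.Perm (Fin d))}

/-- The labels of a vertex cover the image of `[d]` under any permutation representing it, so
disjointness of labels is disjointness of these images. -/
theorem LabelDescription.labelsDisjoint_iff (L : V.LabelDescription m) {k : ℕ} {y z : V.obj (m + k)}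
    {σ τ : Equiv.Perm (Fin (m + k))} (hσ : QuotientGroup.mk σ = L.equiv k y)
    (hτ : QuotientGroup.mk τ = L.equiv k z) :
    L.LabelsDisjoint y z ↔ ∀ i j : Fin L.d,
      σ (Fin.castLE (L.d_le.trans (Nat.le_add_right m k)) i) ≠
        τ (Fin.castLE (L.d_le.trans (Nat.le_add_right m k)) j) := by
  unfold LabelDescription.LabelsDisjoint
  rw [← hσ, ← hτ]
  constructor
  · intro h i j hij
    refine Set.disjoint_left.1 (h i j)
      ((mem_label_mk _ _ _ _ _).2 ⟨i, MulAction.mem_orbit_self i, rfl⟩)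
      ((mem_label_mk _ _ _ _ _).2 ⟨j, MulAction.mem_orbit_self j, hij.symm⟩)
  · intro h a b
    refine Set.disjoint_left.2 fun t ht ht' => ?_
    obtain ⟨i, -, hi⟩ := (mem_label_mk _ _ _ _ _).1 ht
    obtain ⟨j, -, hj⟩ := (mem_label_mk _ _ _ _ _).1 ht'
    exact h i j (hi.trans hj.symm)

namespace IsSupported

/-- The class of `σ` in `𝔖_n / (H × 𝔖_{n-d})` corresponds to the vertex with support
`σ(1), …, σ(d)`. -/
noncomputable def quotientEquiv (hs : V.IsSupported x e H) {n : ℕ} (h : m ≤ n) (hd : d ≤ n) :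
    Equiv.Perm (Fin n) ⧸ blockSubgroup hd H ≃ V.obj n :=
  Equiv.ofBijective (Quotient.lift
    (fun σ : Equiv.Perm (Fin n) => V.vert x e h ((Fin.castLEEmb hd).trans σ.toEmbedding))
    (fun σ τ hst => (hs.vert_eq_iff _ _ _).2
      ((mk_eq_mk_blockSubgroup_iff _ H σ τ).1 (Quotient.sound hst)))) (by
    constructor
    · intro a b
      obtain ⟨σ, rfl⟩ := QuotientGroup.mk_surjective a
      obtain ⟨τ, rfl⟩ := QuotientGroup.mk_surjective b
      intro hst
      exact (mk_eq_mk_blockSubgroup_iff _ H σ τ).2 ((hs.vert_eq_iff _ _ _).1 hst)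
    · intro v
      obtain ⟨f, rfl⟩ := hs.exists_vert_eq h v
      obtain ⟨σ, hσ⟩ := exists_perm_extending (Fin.castLEEmb hd) f
      refine ⟨QuotientGroup.mk σ, ?_⟩
      change V.vert x e _ _ = _
      congr 1
      exact Function.Embedding.ext hσ)

theorem quotientEquiv_smul (hs : V.IsSupported x e H) {n : ℕ} (h : m ≤ n) (hd : d ≤ n)
    (σ : Equiv.Perm (Fin n)) (q : Equiv.Perm (Fin n) ⧸ blockSubgroup hd H) :
    hs.quotientEquiv h hd (σ • q) = V.act σ (hs.quotientEquiv h hd q) := by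
  obtain ⟨τ, rfl⟩ := QuotientGroup.mk_surjective q
  exact (hs.act_vert h ((Fin.castLEEmb hd).trans τ.toEmbedding) σ).symm

/-- The sets `V_n` are described by `d` and `H` for all `n ≥ m`. -/
noncomputable def labelDescription (hs : V.IsSupported x e H) : V.LabelDescription m where
  d := d
  d_le := by have := hs.two_mul_le; omega
  H := H
  equiv := fun k => (hs.quotientEquiv (Nat.le_add_right m k)
    (by have := hs.two_mul_le; omega)).symm
  equivariant := fun k σ v => by
    rw [Equiv.symm_apply_eq, quotientEquiv_smul, Equiv.apply_symm_apply]

end IsSupported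

section

variable (L : V.LabelDescription m) {k : ℕ}

theorem LabelDescription.mk_mul_eq_equiv_act {v : V.obj (m + k)} {σ : Equiv.Perm (Fin (m + k))}
    (hσ : QuotientGroup.mk σ = L.equiv k v) (τ : Equiv.Perm (Fin (m + k))) :
    QuotientGroup.mk (τ * σ) = L.equiv k (V.act τ v) := by
  rw [L.equivariant, ← hσ]; rfl

/-- The union of the labels of the class of `σ`, that is, the image of `[d]` under `σ`. -/
def labelSupport {n : ℕ} (hd : d ≤ n) (σ : Equiv.Perm (Fin n)) : Finset (Fin n) :=
  Finset.univ.map ((Fin.castLEEmb hd).trans σ.toEmbedding)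

theorem LabelDescription.labelSupport_invariant {v : V.obj (m + k)} {σ : Equiv.Perm (Fin (m + k))}
    (hσ : QuotientGroup.mk σ = L.equiv k v) :
    ∀ ρ ∈ V.stab v, ∀ i ∈ labelSupport (L.d_le.trans (Nat.le_add_right m k)) σ,
      ρ i ∈ labelSupport (L.d_le.trans (Nat.le_add_right m k)) σ := by
  intro ρ hρ i hi
  obtain ⟨j, -, rfl⟩ := Finset.mem_map.1 hi
  have h1 := L.mk_mul_eq_equiv_act hσ ρ
  rw [mem_stab.1 hρ, ← hσ, Eq.comm, mk_eq_mk_blockSubgroup_iff] at h1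
  obtain ⟨g, -, hg⟩ := h1
  exact Finset.mem_map.2 ⟨g j, Finset.mem_univ _, (hg j).symm⟩

theorem LabelDescription.swap_mem_of_notMem_labelSupport {v : V.obj (m + k)}
    {σ : Equiv.Perm (Fin (m + k))}
    (hσ : QuotientGroup.mk σ = L.equiv k v) (i j : Fin (m + k))
    (hi : i ∉ labelSupport (L.d_le.trans (Nat.le_add_right m k)) σ)
    (hj : j ∉ labelSupport (L.d_le.trans (Nat.le_add_right m k)) σ) :
    Equiv.swap i j ∈ V.stab v := by
  refine (L.equiv k).injective ?_
  rw [← L.mk_mul_eq_equiv_act hσ, ← hσ, Eq.comm, mk_eq_mk_blockSubgroup_iff]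
  refine ⟨1, one_mem _, fun l => ?_⟩
  refine Equiv.swap_apply_of_ne_of_ne ?_ ?_
  · rintro rfl; exact hi (Finset.mem_map.2 ⟨l, Finset.mem_univ _, rfl⟩)
  · rintro rfl; exact hj (Finset.mem_map.2 ⟨l, Finset.mem_univ _, rfl⟩)

end

namespace IsSupported

section

variable (hs : V.IsSupported x e H) (L : V.LabelDescription m) {k : ℕ}
include hs

/-- The support of `x(n)` has the same characteristic properties as the union of its labels, in any
description: it is invariant under the stabilizer, which contains the transpositions outside. -/
theorem support_invariant {n : ℕ} (h : m ≤ n) : ∀ ρ ∈ V.stab (V.incl h x),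
    ∀ i ∈ Finset.univ.map (e.trans (Fin.castLEEmb h)),
      ρ i ∈ Finset.univ.map (e.trans (Fin.castLEEmb h)) := by
  intro ρ hρ i hi
  obtain ⟨j, -, rfl⟩ := Finset.mem_map.1 hi
  obtain ⟨g, -, hg⟩ := (hs.mem_stab_iff h ρ).1 hρ
  exact Finset.mem_map.2 ⟨g j, Finset.mem_univ _, (hg j).symm⟩

theorem swap_mem_of_notMem_support {n : ℕ} (h : m ≤ n) (i j : Fin n)
    (hi : i ∉ Finset.univ.map (e.trans (Fin.castLEEmb h)))
    (hj : j ∉ Finset.univ.map (e.trans (Fin.castLEEmb h))) :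
    Equiv.swap i j ∈ V.stab (V.incl h x) := by
  refine (hs.mem_stab_iff h _).2 ⟨1, one_mem _, fun l => ?_⟩
  refine Equiv.swap_apply_of_ne_of_ne ?_ ?_
  · rintro rfl; exact hi (Finset.mem_map.2 ⟨l, Finset.mem_univ _, rfl⟩)
  · rintro rfl; exact hj (Finset.mem_map.2 ⟨l, Finset.mem_univ _, rfl⟩)

/-- For large `n` the support of `x(n)` is the union of its labels, which pins down the size of
the labels in any description. -/
theorem d_eq_of_labelDescription : d = L.d := by
  obtain ⟨σ, hσ⟩ := QuotientGroup.mk_surjective (L.equiv (m + 1) (V.incl (by omega) x))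
  have h2 := hs.two_mul_le
  have h3 := L.d_le
  have h4 := eq_of_swap_mem_of_two_mul_card_lt (hs.support_invariant (by omega))
    (L.labelSupport_invariant hσ) (hs.swap_mem_of_notMem_support (by omega))
    (L.swap_mem_of_notMem_labelSupport hσ)
    (by simp; omega) (by simp [labelSupport]; omega)
  simpa [labelSupport] using congrArg Finset.card h4

theorem labelsDisjoint_vert_iff (f : Fin d ↪ Fin (m + k)) :
    L.LabelsDisjoint (V.vert x e (Nat.le_add_right m k) f) (V.stdIncl k x) ↔
      ∀ i j, f i ≠ Fin.castLE (Nat.le_add_right m k) (e j) := by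
  obtain ⟨τ, hτ⟩ := exists_perm_extending (e.trans (Fin.castLEEmb (Nat.le_add_right m k))) f
  obtain ⟨σ, hσ⟩ := QuotientGroup.mk_surjective (L.equiv k (V.incl (Nat.le_add_right m k) x))
  rw [← hs.act_incl _ hτ, stdIncl_eq_incl,
    L.labelsDisjoint_iff (L.mk_mul_eq_equiv_act hσ τ) hσ]
  have hd := hs.d_eq_of_labelDescription L
  have h2 := hs.two_mul_le
  have key := disjoint_map_iff_of_swap_mem (hs.support_invariant (Nat.le_add_right m k))
    (L.labelSupport_invariant hσ) (hs.swap_mem_of_notMem_support (Nat.le_add_right m k))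
    (L.swap_mem_of_notMem_labelSupport hσ)
    (by simpa [labelSupport] using hd) (by simp; omega) τ
  have haux : ∀ {c : ℕ} (φ : Fin c ↪ Fin (m + k)),
      (∀ i ∈ Finset.univ.map φ, τ i ∉ Finset.univ.map φ) ↔ ∀ i j, τ (φ i) ≠ φ j := by
    intro c φ
    simp [Eq.comm]
  rw [haux, labelSupport, haux] at key
  refine key.symm.trans ?_
  refine forall_congr' fun i => forall_congr' fun j => ?_
  rw [hτ]; rfl

end

end IsSupported

end FISet

/-! ### Orbit walks -/

namespace FIGraph

variable {G : FIGraph.{u}} {m : ℕ} {x : G.obj m}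

open Classical in
/-- The walk entry counts the neighbours of `y` in the orbit `b`. -/
theorem orbitWalk_pairOrbit {n : ℕ} (x y : G.obj n) (b : G.PairOrbit x) :
    G.orbitWalk x (G.pairOrbit x y) b =
      ((Finset.univ.filter fun z => G.pairOrbit x z = b ∧ (G.graph n).Adj y z).card : ℝ) /
        ((Finset.univ.filter fun z => (G.graph n).Adj y z).card : ℝ) := by
  have hdeg : (G.graph n).degree y = (Finset.univ.filter fun z => (G.graph n).Adj y z).card := by
    rw [← SimpleGraph.card_neighborFinset_eq_degree, SimpleGraph.neighborFinset_eq_filter]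
  change ∑ z, (if G.pairOrbit x z = b then simpleRandomWalk (G.graph n) y z else 0) = _
  simp only [simpleRandomWalk, Matrix.of_apply, ← ite_and]
  rw [← Finset.sum_filter, Finset.sum_const, nsmul_eq_mul, ← hdeg, mul_one_div]

theorem orbitWalk_nonneg {n : ℕ} (x : G.obj n) (a b : G.PairOrbit x) : 0 ≤ G.orbitWalk x a b := by
  obtain ⟨y, rfl⟩ := G.pairOrbit_surjective x a
  rw [orbitWalk_pairOrbit]
  positivity

theorem orbitWalk_le_one {n : ℕ} (x : G.obj n) (a b : G.PairOrbit x) : G.orbitWalk x a b ≤ 1 := by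
  classical
  obtain ⟨y, rfl⟩ := G.pairOrbit_surjective x a
  rw [orbitWalk_pairOrbit]
  refine div_le_one_of_le₀ (Nat.cast_le.2 (Finset.card_le_card ?_)) (Nat.cast_nonneg _)
  exact Finset.monotone_filter_right _ fun z _ hz => hz.2

theorem orbitWalk_pos {n : ℕ} {x : G.obj n} {a b : G.PairOrbit x} (hab : G.orbitAdj x a b) :
    0 < G.orbitWalk x a b := by
  classical
  obtain ⟨y, z, rfl, rfl, hyz⟩ := hab
  rw [orbitWalk_pairOrbit]
  refine div_pos (Nat.cast_pos.2 (Finset.card_pos.2 ⟨z, ?_⟩))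
    (Nat.cast_pos.2 (Finset.card_pos.2 ⟨z, ?_⟩)) <;> simp [hyz]

theorem sum_orbitWalk {n : ℕ} (x : G.obj n) (hdeg : ∀ y : G.obj n, ∃ z, (G.graph n).Adj y z)
    (a : G.PairOrbit x) : ∑ b, G.orbitWalk x a b = 1 := by
  classical
  obtain ⟨y, rfl⟩ := G.pairOrbit_surjective x a
  obtain ⟨z, hz⟩ := hdeg y
  have hpos : ((Finset.univ.filter fun z => (G.graph n).Adj y z).card : ℝ) ≠ 0 :=
    Nat.cast_ne_zero.2 (Finset.card_ne_zero_of_mem (Finset.mem_filter.2 ⟨Finset.mem_univ z, hz⟩))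
  simp only [orbitWalk_pairOrbit]
  rw [← Finset.sum_div, div_eq_one_iff_eq hpos,
    Finset.card_eq_sum_card_fiberwise (f := G.pairOrbit x) (t := Finset.univ) (fun _ _ => by simp)]
  push_cast
  refine Finset.sum_congr rfl fun b _ => ?_
  rw [Finset.filter_filter]
  simp only [and_comm]

open Classical in
/-- The image of the uniform distribution on the vertices of `G_n` in the orbit graph. -/
noncomputable def orbitMeasure {n : ℕ} (x : G.obj n) (a : G.PairOrbit x) : ℝ :=
  ((Finset.univ.filter fun y => G.pairOrbit x y = a).card : ℝ) / (Fintype.card (G.obj n) : ℝ)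

theorem orbitMeasure_pos {n : ℕ} (x : G.obj n) (a : G.PairOrbit x) : 0 < orbitMeasure x a := by
  classical
  obtain ⟨y, rfl⟩ := G.pairOrbit_surjective x a
  refine div_pos (Nat.cast_pos.2 (Finset.card_pos.2 ⟨y, ?_⟩))
    (Nat.cast_pos.2 (Fintype.card_pos_iff.2 ⟨y⟩))
  simp

theorem sum_orbitMeasure {n : ℕ} (x : G.obj n) : ∑ a, orbitMeasure x a = 1 := by
  classical
  have hpos : (Fintype.card (G.obj n) : ℝ) ≠ 0 :=
    Nat.cast_ne_zero.2 (Fintype.card_pos_iff.2 ⟨x⟩).ne'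
  simp only [orbitMeasure]
  rw [← Finset.sum_div, div_eq_one_iff_eq hpos, ← Finset.card_univ,
    Finset.card_eq_sum_card_fiberwise (f := G.pairOrbit x) (t := Finset.univ) (fun _ _ => by simp)]
  push_cast
  rfl

/-- Vertex transitivity makes `G_n` regular, hence the simple random walk symmetric. -/
theorem simpleRandomWalk_comm {n : ℕ}
    (htr : ∀ v w : G.obj n, ∃ σ : Equiv.Perm (Fin n), G.act σ v = w) (y z : G.obj n) :
    simpleRandomWalk (G.graph n) y z = simpleRandomWalk (G.graph n) z y := by
  classical
  obtain ⟨σ, hσ⟩ := htr y z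
  let e : G.graph n ≃g G.graph n := ⟨G.actEquiv σ, fun {a b} => G.adj_act_iff σ a b⟩
  have hdeg : (G.graph n).degree z = (G.graph n).degree y := by
    have := e.degree_eq y
    rw [← hσ]
    exact this
  simp only [simpleRandomWalk, Matrix.of_apply, (G.graph n).adj_comm y z]
  congr! 3
  exact hdeg.symm

/-- The uniform distribution is stationary for a symmetric walk, and it passes to the quotient. -/
theorem isStationaryDistribution_orbitMeasure {n : ℕ} (x : G.obj n)
    (hdeg : ∀ y : G.obj n, ∃ z, (G.graph n).Adj y z)
    (htr : ∀ v w : G.obj n, ∃ σ : Equiv.Perm (Fin n), G.act σ v = w) :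
    IsStationaryDistribution (G.orbitWalk x) (orbitMeasure x) := by
  classical
  refine ⟨⟨fun a => (orbitMeasure_pos x a).le, sum_orbitMeasure x⟩, ?_⟩
  have hrow : ∀ z : G.obj n, ∑ y, simpleRandomWalk (G.graph n) z y = 1 := fun z => by
    have h1 := sum_orbitWalk x hdeg (G.pairOrbit x z)
    change ∑ b, ∑ y, (if G.pairOrbit x y = b then simpleRandomWalk (G.graph n) z y else 0) = 1 at h1
    rw [Finset.sum_comm] at h1
    simpa using h1
  funext b
  change ∑ a, orbitMeasure x a * G.orbitWalk x a b = orbitMeasure x b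
  have h1 : ∀ a, orbitMeasure x a * G.orbitWalk x a b =
      (∑ y ∈ Finset.univ.filter (fun y => G.pairOrbit x y = a),
        G.orbitWalk x (G.pairOrbit x y) b) / (Fintype.card (G.obj n) : ℝ) := fun a => by
    rw [Finset.sum_congr rfl fun y hy => by rw [(Finset.mem_filter.1 hy).2], Finset.sum_const,
      nsmul_eq_mul, orbitMeasure]
    ring
  rw [Finset.sum_congr rfl fun a _ => h1 a, ← Finset.sum_div, orbitMeasure]
  refine congrArg (· / _) ((Finset.sum_fiberwise _ _ _).trans ?_)
  change ∑ y, ∑ z, (if G.pairOrbit x z = b then simpleRandomWalk (G.graph n) y z else 0) = _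
  rw [Finset.sum_comm, ← Finset.sum_boole]
  refine Finset.sum_congr rfl fun z _ => ?_
  split_ifs
  · rw [Finset.sum_congr rfl fun y _ => simpleRandomWalk_comm htr y z, hrow]
  · simp

theorem OrbitGraphStable.orbitsStable (hx : G.OrbitGraphStable x) : G.toFISet.OrbitsStable x :=
  fun k => (hx k).1

section

variable (hx : G.OrbitGraphStable x)
include hx

theorem OrbitGraphStable.orbitAdj_incl_iff {n : ℕ} (h : m ≤ n) (y z : G.obj m) :
    G.orbitAdj (G.incl h x) (G.pairOrbit _ (G.incl h y)) (G.pairOrbit _ (G.incl h z)) ↔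
      G.orbitAdj x (G.pairOrbit x y) (G.pairOrbit x z) := by
  obtain ⟨k, rfl⟩ := Nat.exists_eq_add_of_le h
  exact (hx k).2 (G.pairOrbit x y) (G.pairOrbit x z)

/-- The edges at `x(n)` are read off from the orbit graph. -/
theorem OrbitGraphStable.adj_base {n N : ℕ} (h : m ≤ n) (h' : m ≤ N) {w : G.obj n} {w' : G.obj N}
    {y : G.obj m} (hw : G.pairOrbit (G.incl h x) (G.incl h y) = G.pairOrbit _ w)
    (hw' : G.pairOrbit (G.incl h' x) (G.incl h' y) = G.pairOrbit _ w')
    (hadj : (G.graph N).Adj (G.incl h' x) w') : (G.graph n).Adj (G.incl h x) w := by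
  have h1 : G.orbitAdj (G.incl h' x) (G.pairOrbit _ (G.incl h' x)) (G.pairOrbit _ w') :=
    ⟨_, _, rfl, rfl, hadj⟩
  rw [← hw', hx.orbitAdj_incl_iff h', ← hx.orbitAdj_incl_iff h, hw] at h1
  obtain ⟨v, z, hv, hz, hvz⟩ := h1
  rw [FISet.eq_of_pairOrbit_self hv] at hvz
  obtain ⟨σ, rfl, hσ⟩ := FISet.pairOrbit_eq_iff.1 hz
  rw [← G.adj_act_iff σ, hσ] at hvz
  exact hvz

variable {d : ℕ} {e : Fin d ↪ Fin m} {H : Subgroup (Equiv.Perm (Fin d))}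
  (hs : G.IsSupported x e H)
include hs

/-- The inclusions `V_n → V_N` reflect adjacency: by transitivity one end may be taken to be `x(n)`.
-/
theorem OrbitGraphStable.adj_incl_iff {n N : ℕ} (h : m ≤ n) (h' : n ≤ N) (v w : G.obj n) :
    (G.graph N).Adj (G.incl h' v) (G.incl h' w) ↔ (G.graph n).Adj v w := by
  refine ⟨fun hadj => ?_, fun hadj => G.map_adj _ hadj⟩
  obtain ⟨σ, rfl⟩ := hs.exists_act_eq h v
  obtain ⟨τ, hτ⟩ := FISet.exists_perm_extends h' σ
  rw [← G.act_act_inv σ w, ← FISet.act_incl_of_extends h' hτ, ← FISet.act_incl_of_extends h' hτ,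
    G.adj_act_iff, FISet.incl_incl] at hadj
  rw [← G.act_act_inv σ w, G.adj_act_iff]
  obtain ⟨y, hy⟩ := hx.orbitsStable.exists_rep h (G.act σ⁻¹ w)
  refine hx.adj_base h (h.trans h') hy ?_ hadj
  have := FISet.pairOrbit_incl h h' hy
  rwa [FISet.incl_incl] at this

/-- `G_n` has no isolated vertices for any `n ≥ m`, since an edge at `x(N)` for one large `N` is seen
in the orbit graph. -/
theorem OrbitGraphStable.exists_adj (hconn : ∀ᶠ n in atTop, (G.graph n).Connected)
    (hnontriv : ∀ᶠ n in atTop, Nontrivial (G.obj n)) {n : ℕ} (h : m ≤ n) (y : G.obj n) :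
    ∃ z, (G.graph n).Adj y z := by
  classical
  obtain ⟨N, ⟨hN, hN'⟩, h'⟩ := ((hconn.and hnontriv).and (eventually_ge_atTop m)).exists
  have hpos := hN.preconnected.degree_pos_of_nontrivial (G.incl h' x)
  obtain ⟨w, hw⟩ := ((G.graph N).degree_pos_iff_exists_adj _).1 hpos
  obtain ⟨z, hz⟩ := hx.orbitsStable.exists_rep h' w
  have h1 := hx.adj_base h h' rfl hz hw
  obtain ⟨σ, rfl⟩ := hs.exists_act_eq h y
  exact ⟨G.act σ (G.incl h z), (G.adj_act_iff σ _ _).2 h1⟩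

omit hs in
/-- The orbit graph is connected, as a quotient of a connected `G_N`. -/
theorem OrbitGraphStable.reflTransGen_orbitAdj (hconn : ∀ᶠ n in atTop, (G.graph n).Connected)
    (a b : G.PairOrbit x) : Relation.ReflTransGen (G.orbitAdj x) a b := by
  obtain ⟨N, hN, h'⟩ := (hconn.and (eventually_ge_atTop m)).exists
  obtain ⟨k, rfl⟩ := Nat.exists_eq_add_of_le h'
  let E := Equiv.ofBijective _ (hx k).1
  have hE : ∀ c, G.orbitIncl x k (E.symm c) = c := fun c => E.apply_symm_apply c
  obtain ⟨y, hy⟩ := G.pairOrbit_surjective _ (E a)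
  obtain ⟨z, hz⟩ := G.pairOrbit_surjective _ (E b)
  have h1 := (SimpleGraph.reachable_iff_reflTransGen y z).1 (hN.preconnected y z)
  have h2 := Relation.ReflTransGen.lift (p := G.orbitAdj x)
    (fun v => E.symm (G.pairOrbit (G.stdIncl k x) v)) (fun v w hvw => by
      change G.orbitAdj x _ _
      rw [← (hx k).2, hE, hE]
      exact ⟨v, w, rfl, rfl, hvw⟩) _ _ h1
  simpa [Function.onFun, hy, hz] using h2

open Classical in
/-- Both the degree and the number of neighbours in an orbit are polynomials in `n`. -/
theorem OrbitGraphStable.exists_poly (a b : G.PairOrbit x) :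
    ∃ p q : Polynomial ℝ, ∀ k : ℕ, G.orbitWalkAt x k a b = p.eval (k : ℝ) / q.eval (k : ℝ) ∧
      ∃ y : G.obj (m + k), q.eval (k : ℝ) =
        ((Finset.univ.filter fun z => (G.graph (m + k)).Adj y z).card : ℝ) := by
  obtain ⟨y, rfl⟩ := G.pairOrbit_surjective x a
  obtain ⟨w, rfl⟩ := G.pairOrbit_surjective x b
  have hadj : ∀ {n N : ℕ} (h : m ≤ n) (h' : n ≤ N) (z : G.obj n),
      (G.graph N).Adj (G.incl (h.trans h') y) (G.incl h' z) ↔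
        (G.graph n).Adj (G.incl h y) z := fun h h' z => by
    rw [← FISet.incl_incl h h', hx.adj_incl_iff hs h h']
  have hadj' : ∀ {n : ℕ} (h : m ≤ n) (σ : Equiv.Perm (Fin n)),
      (∀ i, σ (Fin.castLE h i) = Fin.castLE h i) → ∀ z,
        (G.graph n).Adj (G.incl h y) z → (G.graph n).Adj (G.incl h y) (G.act σ z) := by
    intro n h σ hσ z hz
    rw [← FISet.act_incl_of_fixes h hσ y]
    exact (G.adj_act_iff σ _ _).2 hz
  obtain ⟨q, hq⟩ := hs.exists_poly_card (fun n h z => (G.graph n).Adj (G.incl h y) z) hadj hadj'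
  obtain ⟨p, hp⟩ := hs.exists_poly_card (fun n h z =>
      G.pairOrbit (G.incl h x) z = G.pairOrbit (G.incl h x) (G.incl h w) ∧
        (G.graph n).Adj (G.incl h y) z)
    (fun h h' z => by
      rw [hadj h h', ← FISet.incl_incl h h' w, hx.orbitsStable.pairOrbit_incl_iff h h'])
    (fun h σ hσ z hz => ⟨by
      rw [FISet.pairOrbit_act (FISet.act_incl_of_fixes h hσ x), hz.1], hadj' h σ hσ z hz.2⟩)
  refine ⟨p, q, fun k => ⟨?_, _, hq k⟩⟩
  rw [hp, hq]
  refine (orbitWalk_pairOrbit (G.incl (Nat.le_add_right m k) x)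
    (G.incl (Nat.le_add_right m k) y) (G.pairOrbit _ (G.incl (Nat.le_add_right m k) w))).trans ?_
  congr!

end

end FIGraph

theorem IsStationaryDistribution.submatrix {X Y : Type u} [Fintype X] [Fintype Y]
    {P : Matrix X X ℝ} {π : X → ℝ} (hπ : IsStationaryDistribution P π) {φ : Y → X}
    (hφ : Function.Bijective φ) : IsStationaryDistribution (P.submatrix φ φ) (π ∘ φ) := by
  refine ⟨⟨fun a => hπ.1.1 _, ?_⟩, ?_⟩
  · rw [← hπ.1.2]
    exact hφ.sum_comp π
  · funext b
    have h1 := congrFun hπ.2 (φ b)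
    simp only [Matrix.vecMul, dotProduct] at h1 ⊢
    rw [Function.comp_apply, ← h1]
    exact hφ.sum_comp fun a => π a * P a (φ b)

/-! ### Limits and stationary distributions -/

namespace FISet

variable {V : FISet.{u}} {m d : ℕ} {x : V.obj m} {e : Fin d ↪ Fin m}
  {H : Subgroup (Equiv.Perm (Fin d))}

theorem IsSupported.exists_disjoint (hs : V.IsSupported x e H) :
    ∃ f : Fin d ↪ Fin m, ∀ i j, f i ≠ e j := by
  have h2 := hs.two_mul_le
  obtain ⟨f, hf⟩ := Function.Embedding.exists_of_card_le_finset
    (α := Fin d) (s := (Finset.univ.map e)ᶜ) (by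
      rw [Finset.card_compl, Finset.card_map, Finset.card_univ, Fintype.card_fin, Fintype.card_fin]
      omega)
  refine ⟨f, fun i j hij => ?_⟩
  have := hf ⟨i, rfl⟩
  rw [Finset.mem_coe, Finset.mem_compl] at this
  exact this (Finset.mem_map.2 ⟨j, Finset.mem_univ _, hij.symm⟩)

end FISet

namespace FIGraph

variable {G : FIGraph.{u}} {m : ℕ} {x : G.obj m}

open Classical in
/-- Among the `(m+k)(m+k-1)⋯(m+k-d+1)` ordered supports, those disjoint from the support of `x`
number `(m+k-d)⋯(m+k-2d+1) ≥ k ^ d`. -/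
theorem le_orbitMeasure_of_disjoint {d : ℕ} {e : Fin d ↪ Fin m} {H : Subgroup (Equiv.Perm (Fin d))}
    (hs : G.IsSupported x e H) (k : ℕ) {f : Fin d ↪ Fin (m + k)}
    (hf : ∀ i j, f i ≠ Fin.castLE (Nat.le_add_right m k) (e j)) :
    ((k : ℝ) / (k + m)) ^ d ≤ orbitMeasure (G.stdIncl k x)
      (G.pairOrbit (G.stdIncl k x) (G.vert x e (Nat.le_add_right m k) f)) := by
  have h := Nat.le_add_right m k
  have hH : (Fintype.card H : ℝ) ≠ 0 := Nat.cast_ne_zero.2 Fintype.card_ne_zero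
  have h2 := hs.two_mul_le
  have hall := hs.card_filter_vert h (fun _ => True)
  have hdis := hs.card_filter_vert h (fun v => G.pairOrbit (G.incl h x) v =
    G.pairOrbit (G.incl h x) (G.vert x e h f))
  rw [Finset.filter_true, Finset.filter_true, Finset.card_univ, Finset.card_univ,
    Fintype.card_embedding_eq, Fintype.card_fin, Fintype.card_fin] at hall
  have hupper : Fintype.card (G.obj (m + k)) * Fintype.card H ≤ (m + k) ^ d :=
    hall ▸ Nat.descFactorial_le_pow _ _
  have hlower : k ^ d ≤ (Finset.univ.filter fun v => G.pairOrbit (G.incl h x) v =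
      G.pairOrbit (G.incl h x) (G.vert x e h f)).card * Fintype.card H := by
    rw [← hdis]
    let A := {t : Fin (m + k) // t ∉ Finset.univ.map (e.trans (Fin.castLEEmb h))}
    have hA : Fintype.card A = m + k - d := by
      rw [Fintype.card_subtype_compl, Fintype.card_fin, Fintype.card_coe, Finset.card_map,
        Finset.card_univ, Fintype.card_fin]
    let F : (Fin d ↪ A) → (Fin d ↪ Fin (m + k)) := fun g => g.trans (Function.Embedding.subtype _)
    have hF : Function.Injective F := fun g g' hgg =>
      Function.Embedding.ext fun i => Subtype.ext (DFunLike.congr_fun hgg i)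
    calc k ^ d ≤ (m + k - d + 1 - d) ^ d := Nat.pow_le_pow_left (by omega) d
      _ ≤ (m + k - d).descFactorial d := Nat.pow_sub_le_descFactorial _ _
      _ = (Finset.univ.image F).card := by
        rw [Finset.card_image_of_injective _ hF, Finset.card_univ, Fintype.card_embedding_eq, hA,
          Fintype.card_fin]
      _ ≤ _ := by
        refine Finset.card_le_card fun f' hf' => ?_
        obtain ⟨g, -, rfl⟩ := Finset.mem_image.1 hf'
        refine Finset.mem_filter.2 ⟨Finset.mem_univ _, ((hs.pairOrbit_vert_eq_iff h hf _).2 ?_).symm⟩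
        exact fun i j hij => (g i).2 (Finset.mem_map.2 ⟨j, Finset.mem_univ _, hij.symm⟩)
  have hcard : (0 : ℝ) < Fintype.card (G.obj (m + k)) :=
    Nat.cast_pos.2 (Fintype.card_pos_iff.2 ⟨G.stdIncl k x⟩)
  have hHpos : (0 : ℝ) < Fintype.card H := Nat.cast_pos.2 Fintype.card_pos
  have hu : (Fintype.card (G.obj (m + k)) : ℝ) * Fintype.card H ≤ (k + m) ^ d := by
    rw [add_comm (k : ℝ)]; exact_mod_cast hupper
  unfold orbitMeasure
  rw [div_pow, ← mul_div_mul_right (Nat.cast (Finset.card _)) _ hH]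
  exact div_le_div₀ (by positivity) (by exact_mod_cast hlower) (by positivity) hu

section

variable (hx : G.OrbitGraphStable x)
include hx

theorem OrbitGraphStable.isTransitionMatrix
    (hdeg : ∀ {n : ℕ}, m ≤ n → ∀ y : G.obj n, ∃ z, (G.graph n).Adj y z) (k : ℕ) :
    IsTransitionMatrix (G.orbitWalkAt x k) := by
  classical
  refine Matrix.mem_rowStochastic_iff_sum.2 ⟨fun a b => orbitWalk_nonneg _ _ _, fun a => ?_⟩
  rw [← sum_orbitWalk (G.stdIncl k x) (hdeg (Nat.le_add_right m k)) (G.orbitIncl x k a)]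
  exact (hx k).1.sum_comp fun b => G.orbitWalk (G.stdIncl k x) (G.orbitIncl x k a) b

omit hx in
theorem orbitWalkAt_zero : G.orbitWalkAt x 0 = G.orbitWalk x := by
  have h0 : ∀ y : G.obj m, G.stdIncl 0 y = y := fun y => G.map_refl y
  ext a b
  obtain ⟨y, rfl⟩ := G.pairOrbit_surjective x a
  obtain ⟨w, rfl⟩ := G.pairOrbit_surjective x b
  change G.orbitWalk (G.stdIncl 0 x) (G.pairOrbit _ (G.stdIncl 0 y))
    (G.pairOrbit _ (G.stdIncl 0 w)) = _
  have key : ∀ x' y' w' : G.obj m, x' = x → y' = y → w' = w →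
      G.orbitWalk x' (G.pairOrbit x' y') (G.pairOrbit x' w') =
        G.orbitWalk x (G.pairOrbit x y) (G.pairOrbit x w) := by
    rintro _ _ _ rfl rfl rfl
    rfl
  exact key _ _ _ (h0 x) (h0 y) (h0 w)

variable {d : ℕ} {e : Fin d ↪ Fin m} {H : Subgroup (Equiv.Perm (Fin d))}
  (hs : G.IsSupported x e H)
  (hdeg : ∀ {n : ℕ}, m ≤ n → ∀ y : G.obj n, ∃ z, (G.graph n).Adj y z)
include hs hdeg

theorem OrbitGraphStable.exists_isRationalTransition :
    ∃ Q, IsRationalTransition (G.orbitWalk x) Q (fun k => G.orbitWalkAt x k) := by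
  classical
  choose p q hpq using hx.exists_poly hs
  have hq : ∀ a b (k : ℕ), (q a b).eval (k : ℝ) ≠ 0 := fun a b k => by
    obtain ⟨y, hy⟩ := (hpq a b k).2
    obtain ⟨z, hz⟩ := hdeg (Nat.le_add_right m k) y
    rw [hy]
    exact Nat.cast_ne_zero.2
      (Finset.card_ne_zero_of_mem (Finset.mem_filter.2 ⟨Finset.mem_univ z, hz⟩))
  have hlim : ∀ a b, ∃ l, Tendsto (fun k => G.orbitWalkAt x k a b) atTop (𝓝 l) := fun a b => by
    simp only [fun k => (hpq a b k).1]
    refine Polynomial.exists_tendsto_eval_div_eval _ _ fun k => ?_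
    rw [← (hpq a b k).1]
    exact abs_le.2 ⟨(neg_nonpos.2 zero_le_one).trans (orbitWalk_nonneg _ _ _),
      orbitWalk_le_one _ _ _⟩
  choose Q hQ using hlim
  have htm := hx.isTransitionMatrix hdeg
  refine ⟨Q, orbitWalkAt_zero (x := x) ▸ htm 0, ?_, htm,
    ⟨fun a b => algebraMap _ _ (p a b) / algebraMap _ _ (q a b), fun k a b => ?_⟩,
    orbitWalkAt_zero, tendsto_pi_nhds.2 fun a => tendsto_pi_nhds.2 fun b => hQ a b⟩
  · refine Matrix.mem_rowStochastic_iff_sum.2 ⟨fun a b => ge_of_tendsto' (hQ a b) fun k =>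
      orbitWalk_nonneg _ _ _, fun a => ?_⟩
    refine tendsto_nhds_unique (tendsto_finsetSum _ fun b _ => hQ a b) ?_
    simp only [fun k => (Matrix.mem_rowStochastic_iff_sum.1 (htm k)).2 a]
    exact tendsto_const_nhds
  · have := RatFunc.eval_algebraMap_div (p a b) (q a b) (hq a b k)
    exact ⟨this.1, (hpq a b k).1.trans this.2.symm⟩

theorem OrbitGraphStable.isStationaryDistribution (k : ℕ) :
    IsStationaryDistribution (G.orbitWalkAt x k)
      (orbitMeasure (G.stdIncl k x) ∘ G.orbitIncl x k) :=
  (isStationaryDistribution_orbitMeasure _ (hdeg (Nat.le_add_right m k))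
    (hs.transitive (Nat.le_add_right m k))).submatrix (hx k).1

theorem OrbitGraphStable.isStationaryDistribution_unique
    (hconn : ∀ᶠ n in atTop, (G.graph n).Connected) (k : ℕ) {ρ : G.PairOrbit x → ℝ}
    (hρ : IsStationaryDistribution (G.orbitWalkAt x k) ρ) :
    ρ = orbitMeasure (G.stdIncl k x) ∘ G.orbitIncl x k :=
  (hx.isStationaryDistribution hs hdeg k).unique (fun _ _ => orbitWalk_nonneg _ _ _)
    (fun a b => Relation.ReflTransGen.mono (fun c c' hcc =>
      orbitWalk_pos (((hx k).2 c c').2 hcc)) _ _ (hx.reflTransGen_orbitAdj hconn a b))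
    (fun _ => orbitMeasure_pos _ _) hρ

end

end FIGraph

/-- A limit of probability vectors in which one coordinate tends to `1` is a point mass. -/
theorem tendsto_pi_single_of_mem_stdSimplex {X : Type u} [Fintype X] [DecidableEq X]
    {π : ℕ → X → ℝ} (hπ : ∀ k, π k ∈ stdSimplex ℝ X) {a : X}
    (ha : Tendsto (fun k => π k a) atTop (𝓝 1)) : Tendsto π atTop (𝓝 (Pi.single a 1)) := by
  refine tendsto_pi_nhds.2 fun b => ?_
  by_cases hb : b = a
  · subst hb
    simpa using ha
  · rw [Pi.single_eq_of_ne hb]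
    have h1 : Tendsto (fun k => 1 - π k a) atTop (𝓝 0) := by
      simpa using ha.const_sub 1
    refine squeeze_zero (fun k => (hπ k).1 b) (fun k => ?_) h1
    rw [← (hπ k).2, le_sub_iff_add_le, ← Finset.sum_pair hb]
    exact Finset.sum_le_sum_of_subset_of_nonneg (Finset.subset_univ _) fun c _ _ => (hπ k).1 c

theorem IsStationaryDistribution.of_tendsto {X : Type u} [Fintype X] {P : ℕ → Matrix X X ℝ}
    {Q : Matrix X X ℝ} {π : ℕ → X → ℝ} {ρ : X → ℝ} (h : ∀ k, IsStationaryDistribution (P k) (π k))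
    (hP : Tendsto P atTop (𝓝 Q)) (hπ : Tendsto π atTop (𝓝 ρ)) : IsStationaryDistribution Q ρ := by
  refine ⟨(isClosed_stdSimplex ℝ X).mem_of_tendsto hπ (Eventually.of_forall fun k => (h k).1), ?_⟩
  have h1 : Tendsto (fun k => Matrix.vecMul (π k) (P k)) atTop (𝓝 (Matrix.vecMul ρ Q)) := by
    refine tendsto_pi_nhds.2 fun b => tendsto_finsetSum _ fun a _ => ?_
    exact (tendsto_pi_nhds.1 hπ a).mul (tendsto_pi_nhds.1 (tendsto_pi_nhds.1 hP a) b)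
  simp only [fun k => (h k).2] at h1
  exact tendsto_nhds_unique h1 hπ

open Classical in
theorem mainTheorem6 (G : FIGraph.{u}) (hG : G.IsTransitive)
    (hconn : ∀ᶠ n in atTop, (G.graph n).Connected)
    (hnontriv : ∀ᶠ n in atTop, Nontrivial (G.obj n))
    (m : ℕ) (x : G.obj m) (hx : G.OrbitGraphStable x) :
    ∃ Q : Matrix (G.PairOrbit x) (G.PairOrbit x) ℝ,
      IsRationalTransition (G.orbitWalk x) Q (fun k => G.orbitWalkAt x k) ∧
      Nonempty (G.LabelDescription m) ∧
      ∀ L : G.LabelDescription m, ∃ πInf : G.PairOrbit x → ℝ,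
        (∀ (k : ℕ) (a : G.PairOrbit x) (y : G.obj (m + k)),
          G.orbitIncl x k a = G.pairOrbit (G.stdIncl k x) y →
            πInf a = if L.LabelsDisjoint y (G.stdIncl k x) then 1 else 0) ∧
        IsStationaryDistribution Q πInf ∧
        ∃ π : ℕ → G.PairOrbit x → ℝ,
          (∀ k, IsStationaryDistribution (G.orbitWalkAt x k) (π k) ∧
            ∀ ρ, IsStationaryDistribution (G.orbitWalkAt x k) ρ → ρ = π k) ∧
          Tendsto π atTop (𝓝 πInf) := by
  obtain ⟨d, e, H, hs⟩ := hx.orbitsStable.exists_isSupported hG.2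
  have hdeg : ∀ {n : ℕ}, m ≤ n → ∀ y : G.obj n, ∃ z, (G.graph n).Adj y z :=
    fun h y => hx.exists_adj hs hconn hnontriv h y
  obtain ⟨Q, hQ⟩ := hx.exists_isRationalTransition hs hdeg
  obtain ⟨f, hf⟩ := hs.exists_disjoint
  refine ⟨Q, hQ, ⟨hs.labelDescription⟩, fun L => ?_⟩
  -- The orbit of the vertices with support disjoint from that of `x`.
  let a₀ := G.pairOrbit x (G.vert x e le_rfl f)
  have hf' : ∀ (k : ℕ) (i j : Fin d), (f.trans (Fin.castLEEmb (Nat.le_add_right m k))) i ≠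
      Fin.castLE (Nat.le_add_right m k) (e j) := fun k i j hij =>
    hf i j (Fin.castLE_injective _ hij)
  have ha₀ : ∀ k, G.orbitIncl x k a₀ = G.pairOrbit (G.stdIncl k x)
      (G.vert x e (Nat.le_add_right m k) (f.trans (Fin.castLEEmb (Nat.le_add_right m k)))) :=
    fun k => congrArg (G.pairOrbit (G.stdIncl k x)) (hs.incl_vert le_rfl (Nat.le_add_right m k) f)
  let π : ℕ → G.PairOrbit x → ℝ :=
    fun k => FIGraph.orbitMeasure (G.stdIncl k x) ∘ G.orbitIncl x k
  have hπ : ∀ k, IsStationaryDistribution (G.orbitWalkAt x k) (π k) :=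
    fun k => hx.isStationaryDistribution hs hdeg k
  have hπ₀ : Tendsto (fun k => π k a₀) atTop (𝓝 1) := by
    have h1 : Tendsto (fun k : ℕ => ((k : ℝ) / (k + m)) ^ d) atTop (𝓝 1) := by
      simpa using (tendsto_natCast_div_add_atTop (m : ℝ)).pow d
    refine tendsto_of_tendsto_of_tendsto_of_le_of_le h1 tendsto_const_nhds (fun k => ?_)
      (fun k => ?_)
    · change _ ≤ FIGraph.orbitMeasure _ (G.orbitIncl x k a₀)
      rw [ha₀]
      exact FIGraph.le_orbitMeasure_of_disjoint hs k (hf' k)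
    · rw [← (hπ k).1.2]
      exact Finset.single_le_sum (fun b _ => (hπ k).1.1 b) (Finset.mem_univ a₀)
  have hlim := tendsto_pi_single_of_mem_stdSimplex (fun k => (hπ k).1) hπ₀
  refine ⟨Pi.single a₀ 1, fun k a y hay => ?_, .of_tendsto hπ hQ.tendsto hlim, π,
    fun k => ⟨hπ k, fun ρ hρ => hx.isStationaryDistribution_unique hs hdeg hconn k hρ⟩, hlim⟩
  obtain ⟨f', rfl⟩ := hs.exists_vert_eq (Nat.le_add_right m k) y
  rw [Pi.single_apply]
  refine if_congr ?_ rfl rfl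
  rw [hs.labelsDisjoint_vert_iff L f', ← hs.pairOrbit_vert_eq_iff _ (hf' k) f', Eq.comm,
    ← (hx k).1.1.eq_iff, ha₀, hay, FISet.stdIncl_eq_incl]
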